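/- All $C^*$-algebras are unital and $\otimes$ is the minimal (spatial) tensor product. Let $\Gamma=(V,E,s,r)$ be a finite directed graph (loops and multiple edges allowed) that is connected in the sense that every vertex is the source or the range of some edge. Let $C^*(\Gamma)$ be its graph $C^*$-algebra: the universal $C^*$-algebra generated by mutually orthogonal projections $p_v$ ($v\in V$) with $\sum_v p_v=1$ and partial isometries $S_e$ ($e\in E$) such that $S_e^*S_e=p_{r(e)}$ for all $e$, and $p_v=\sum_{s(f)=v}S_fS_f^*$ whenever $s^{-1}(v)\neq\emptyset$. A compact quantum group is a pair $(Q,\Delta)$ of a $C^*$-algebra $Q$ and a unital $*$-homomorphism $\Delta:Q\to Q\otimes Q$ with $(\mathrm{id}\otimes\Delta)\Delta=(\Delta\otimes\mathrm{id})\Delta$ such that $\Delta(Q)(1\otimes Q)$ and $\Delta(Q)(Q\otimes1)$ have dense linear span in $Q\otimes Q$; a morphism $(Q_1,\Delta_1)\to(Q_2,\Delta_2)$ is a unital $*$-homomorphism $\Phi$ with $(\Phi\otimes\Phi)\Delta_1=\Delta_2\Phi$. Let $\mathcal V_{2,+}\subseteq C^*(\Gamma)$ be the span of the $p_u$, where $u$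 is a vertex that is not the source of an edge, and of the $S_eS_f^*$ with $r(e)=r(f)$, and let $\tau$ be the linear functional on $\mathcal V_{2,+}$ with $\tau(p_u)=1$ and $\tau(S_eS_f^*)=\delta_{ef}$ on these elements. The objects of the category $\mathfrak C_\tau^{Lin}$ are the pairs $((Q,\Delta),\alpha)$ of a compact quantum group and a unital $*$-homomorphism $\alpha:C^*(\Gamma)\to C^*(\Gamma)\otimes Q$ such that * $(\alpha\otimes\mathrm{id})\alpha=(\mathrm{id}\otimes\Delta)\alpha$, and $\alpha(C^*(\Gamma))(1\otimes Q)$ has dense linear span; * $\alpha$ is faithful: the $*$-algebra generated by the $(\theta\otimes\mathrm{id})\alpha(x)$, $\theta\in C^*(\Gamma)^*$, $x\in C^*(\Gamma)$, is dense in $Q$; * $\alpha$ is linear: $\alpha(S_e)=\sum_{f\in E}S_f\otimes q_{fe}$ for some $q_{fe}\in Q$; * $(\tau\otimes\mathrm{id})\alpha(x)=\tau(x)1$ for all $x\in\mathcal V_{2,+}$ (where $\alpha(x)$ is an element of the algebraic tensor product of $\mathcal V_{2,+}$ and $Q$). An object $((Q,\Delta),\alpha)$ is universal if for every object $((B,\Delta'),\beta)$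 there is a surjective morphism $\Phi:(Q,\Delta)\to(B,\Delta')$ with $(\mathrm{id}\otimes\Phi)\alpha=\beta$; $Q_\tau^{Lin}$ denotes the compact quantum group of the universal object. Let $F=C(S^1)*\cdots*C(S^1)$ ($|E|$ copies) be the universal $C^*$-algebra generated by unitaries $z_e$ ($e\in E$), with the comultiplication $\Delta_*(z_e)=z_e\otimes z_e$. For an automorphism $\varphi$ of a compact quantum group $(Q,\Delta)$ with $\varphi^2=\mathrm{id}$, the doubling $(\mathcal D_\varphi(Q),\Delta_\varphi)$ has the underlying $C^*$-algebra $Q\oplus Q$ and the comultiplication given by $\Delta_\varphi\zeta=(\zeta\otimes\zeta+\eta\otimes\eta\varphi)\Delta$ and $\Delta_\varphi\eta=(\zeta\otimes\eta+\eta\otimes\zeta\varphi)\Delta$, where $\zeta(a)=(a,0)$ and $\eta(a)=(0,a)$. Then: 1. Suppose that $e_1\neq e_2$ are edges with $s(e_1)=s(e_2)$ and $r(e_1)=r(e_2)$. Then $(F,\Delta_*)$ is a compact quantum group, and there is an automorphism $\varphi$ of it with $\varphi^2=\mathrm{id}$, $\varphi(z_{e_1})=z_{e_2}$, $\varphi(z_{e_2})=z_{e_1}$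 and $\varphi(z_k)=z_k$ for $k\neq e_1,e_2$. Moreover there is a unital $*$-homomorphism $\alpha:C^*(\Gamma)\to C^*(\Gamma)\otimes\mathcal D_\varphi(F)$ with $$\alpha(S_{e_1})=S_{e_1}\otimes(z_{e_1},0)+S_{e_2}\otimes(0,z_{e_2}),\quad \alpha(S_{e_2})=S_{e_2}\otimes(z_{e_2},0)+S_{e_1}\otimes(0,z_{e_1}),\quad \alpha(S_k)=S_k\otimes(z_k,z_k)\ \ (k\neq e_1,e_2),$$ and $((\mathcal D_\varphi(F),\Delta_\varphi),\alpha)$ is an object of $\mathfrak C_\tau^{Lin}$; in particular $(\mathcal D_\varphi(F),\Delta_\varphi)$ is a compact quantum group that acts faithfully on $C^*(\Gamma)$. Furthermore $Q_\tau^{Lin}$ is not isomorphic to $(F,\Delta_*)$ as a compact quantum group. 2. Consequently, if $Q_\tau^{Lin}$ is isomorphic to $(F,\Delta_*)$ as a compact quantum group, then $\Gamma$ satisfies condition (R3): for any two (possibly equal) vertices $v,w$ there is at most one edge with source $v$ and range $w$. -/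

import Mathlib

open scoped TensorProduct

universe u

noncomputable section

/-! ### C*-seminorms and the associated C*-algebra -/

/-- A C*-seminorm on a complex unital `*`-algebra. -/
structure CStarSeminorm (A : Type u) [Ring A] [StarRing A] [Algebra ℂ A] where
  toFun : A → ℝ
  nonneg' : ∀ x, 0 ≤ toFun x
  add_le' : ∀ x y, toFun (x + y) ≤ toFun x + toFun y
  smul' : ∀ (c : ℂ) x, toFun (c • x) = ‖c‖ * toFun x
  mul_le' : ∀ x y, toFun (x * y) ≤ toFun x * toFun y
  star_mul_self' : ∀ x, toFun (star x * x) = toFun x ^ 2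

namespace CStarSeminorm

variable {A : Type u} [Ring A] [StarRing A] [Algebra ℂ A]

theorem map_zero' (p : CStarSeminorm A) : p.toFun 0 = 0 := by
  simpa using p.smul' 0 0

theorem map_neg' (p : CStarSeminorm A) (x : A) : p.toFun (-x) = p.toFun x := by
  simpa using p.smul' (-1) x

theorem le_star (p : CStarSeminorm A) (x : A) : p.toFun x ≤ p.toFun (star x) := by
  have h := (p.star_mul_self' x).symm.trans_le (p.mul_le' (star x) x)
  rcases (p.nonneg' x).eq_or_lt with h0 | h0
  · rw [← h0]; exact p.nonneg' _
  · rw [sq] at h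
    exact le_of_mul_le_mul_right h h0

theorem map_star' (p : CStarSeminorm A) (x : A) : p.toFun (star x) = p.toFun x :=
  le_antisymm (by simpa using p.le_star (star x)) (p.le_star x)

/-- The pointwise supremum of a pointwise bounded set of C*-seminorms. -/
def sup (S : Set (CStarSeminorm A)) (hS : ∀ x, ∃ C : ℝ, ∀ p ∈ S, p.toFun x ≤ C) :
    CStarSeminorm A :=
  have bdd : ∀ x, BddAbove (Set.range fun p : S => p.1.toFun x) := fun x => by
    obtain ⟨C, hC⟩ := hS x
    exact ⟨C, by rintro _ ⟨p, rfl⟩; exact hC _ p.2⟩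
  { toFun := fun x => ⨆ p : S, p.1.toFun x
    nonneg' := fun x => Real.iSup_nonneg fun p => p.1.nonneg' x
    add_le' := fun x y => Real.iSup_le
      (fun p => (p.1.add_le' x y).trans (add_le_add (le_ciSup (bdd x) p) (le_ciSup (bdd y) p)))
      (add_nonneg (Real.iSup_nonneg fun p => p.1.nonneg' x)
        (Real.iSup_nonneg fun p => p.1.nonneg' y))
    smul' := fun c x => by
      simp only [smul']
      exact (Real.mul_iSup_of_nonneg (norm_nonneg c) _).symm
    mul_le' := fun x y => Real.iSup_le
      (fun p => (p.1.mul_le' x y).trans (mul_le_mul (le_ciSup (bdd x) p) (le_ciSup (bdd y) p)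
        (p.1.nonneg' y) (Real.iSup_nonneg fun p => p.1.nonneg' x)))
      (mul_nonneg (Real.iSup_nonneg fun p => p.1.nonneg' x)
        (Real.iSup_nonneg fun p => p.1.nonneg' y))
    star_mul_self' := fun x => by
      have h0 : 0 ≤ ⨆ p : S, p.1.toFun x := Real.iSup_nonneg fun p => p.1.nonneg' x
      apply le_antisymm
      · refine Real.iSup_le (fun p => ?_) (by positivity)
        rw [p.1.star_mul_self']
        exact pow_le_pow_left₀ (p.1.nonneg' x) (le_ciSup (bdd x) p) 2
      · have h1 : 0 ≤ ⨆ p : S, p.1.toFun (star x * x) := Real.iSup_nonneg fun p => p.1.nonneg' _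
        rw [← Real.le_sqrt h0 h1]
        refine Real.iSup_le (fun p => ?_) (Real.sqrt_nonneg _)
        rw [Real.le_sqrt (p.1.nonneg' x) h1, ← p.1.star_mul_self']
        exact le_ciSup (bdd _) p }

theorem le_sup (S : Set (CStarSeminorm A)) (hS : ∀ x, ∃ C : ℝ, ∀ p ∈ S, p.toFun x ≤ C)
    {p : CStarSeminorm A} (hp : p ∈ S) (x : A) : p.toFun x ≤ (sup S hS).toFun x := by
  obtain ⟨C, hC⟩ := hS x
  exact le_ciSup (f := fun p : S => p.1.toFun x)
    ⟨C, by rintro _ ⟨p, rfl⟩; exact hC _ p.2⟩ ⟨p, hp⟩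

theorem sup_le (S : Set (CStarSeminorm A)) (hS : ∀ x, ∃ C : ℝ, ∀ p ∈ S, p.toFun x ≤ C)
    (x : A) {C : ℝ} (h0 : 0 ≤ C) (hC : ∀ p ∈ S, p.toFun x ≤ C) : (sup S hS).toFun x ≤ C :=
  Real.iSup_le (fun p => hC _ p.2) h0

/-- The C*-seminorm `x ↦ ‖T x‖` of a `*`-representation `T` by bounded operators on a (not
necessarily complete) inner product space. -/
def ofOperators {E : Type u} [NormedAddCommGroup E] [InnerProductSpace ℂ E]
    (T : A →ₗ[ℂ] (E →L[ℂ] E)) (hmul : ∀ x y, T (x * y) = T x * T y)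
    (hstar : ∀ x ξ η, inner ℂ (T (star x) ξ) η = inner ℂ ξ (T x η)) : CStarSeminorm A :=
  have h1 : ∀ x, ‖T x‖ ^ 2 ≤ ‖T (star x * x)‖ := fun x => by
    rw [← Real.le_sqrt (norm_nonneg _) (norm_nonneg _)]
    refine ContinuousLinearMap.opNorm_le_bound _ (Real.sqrt_nonneg _) fun ξ => ?_
    have h : ‖T x ξ‖ ^ 2 ≤ ‖T (star x * x)‖ * ‖ξ‖ ^ 2 := by
      rw [← inner_self_eq_norm_sq (𝕜 := ℂ), ← hstar, ← mul_apply_eq_comp, ← hmul]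
      refine (RCLike.re_le_norm _).trans ((norm_inner_le_norm _ _).trans ?_)
      rw [sq, ← mul_assoc]
      exact mul_le_mul_of_nonneg_right (ContinuousLinearMap.le_opNorm _ _) (norm_nonneg _)
    rw [← Real.sqrt_sq (norm_nonneg (T x ξ)), ← Real.sqrt_sq (norm_nonneg ξ),
      ← Real.sqrt_mul (norm_nonneg _)]
    exact Real.sqrt_le_sqrt h
  { toFun := fun x => ‖T x‖
    nonneg' := fun x => norm_nonneg _
    add_le' := fun x y => by rw [map_add]; exact norm_add_le _ _
    smul' := fun c x => by rw [map_smul, norm_smul]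
    mul_le' := fun x y => by rw [hmul]; exact norm_mul_le _ _
    star_mul_self' := fun x => by
      have key : ∀ y, ‖T y‖ ≤ ‖T (star y)‖ := fun y => by
        have h := h1 y
        rw [hmul] at h
        replace h := h.trans (norm_mul_le _ _)
        rcases (norm_nonneg (T y)).eq_or_lt with h0 | h0
        · rw [← h0]; exact norm_nonneg _
        · rw [sq] at h
          exact le_of_mul_le_mul_right h h0
      refine le_antisymm ?_ (h1 x)
      rw [hmul, sq]
      refine (norm_mul_le _ _).trans (mul_le_mul_of_nonneg_right ?_ (norm_nonneg _))
      simpa using key (star x) }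

/-- The `*`-algebra `A`, regarded as a seminormed algebra with seminorm `p`. -/
def Pre (_p : CStarSeminorm A) : Type u := A

variable (p : CStarSeminorm A)

instance : Ring p.Pre := inferInstanceAs (Ring A)
instance : StarRing p.Pre := inferInstanceAs (StarRing A)
instance : Algebra ℂ p.Pre := inferInstanceAs (Algebra ℂ A)
instance [StarModule ℂ A] : StarModule ℂ p.Pre := inferInstanceAs (StarModule ℂ A)

/-- The identity map from `A` to `p.Pre`. -/
def toPre : A →⋆ₐ[ℂ] p.Pre := StarAlgHom.id ℂ A

instance : SeminormedRing p.Pre :=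
  { AddGroupSeminorm.toSeminormedAddCommGroup (E := p.Pre)
      { toFun := p.toFun
        map_zero' := p.map_zero'
        add_le' := p.add_le'
        neg' := p.map_neg' },
    (inferInstanceAs (Ring A) : Ring p.Pre) with
    norm_mul_le := p.mul_le' }

theorem norm_toPre (x : A) : ‖p.toPre x‖ = p.toFun x := rfl

instance : NormedAlgebra ℂ p.Pre where
  norm_smul_le c x := (p.smul' c x).le

/-- The C*-algebra obtained from `A` by dividing out the null space of `p` and completing. -/
def Compl : Type u := UniformSpace.Completion p.Pre

instance : NormedRing p.Compl := inferInstanceAs (NormedRing (UniformSpace.Completion p.Pre))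
instance : CompleteSpace p.Compl :=
  inferInstanceAs (CompleteSpace (UniformSpace.Completion p.Pre))
instance : Algebra ℂ p.Compl := inferInstanceAs (Algebra ℂ (UniformSpace.Completion p.Pre))
instance : NormedAlgebra ℂ p.Compl where
  norm_smul_le c x :=
    (inferInstance : NormedSpace ℂ (UniformSpace.Completion p.Pre)).norm_smul_le c x

/-- The canonical map from `A` to the completion. -/
def coeFun (x : A) : p.Compl := ((p.toPre x : p.Pre) : UniformSpace.Completion p.Pre)

theorem norm_coeFun (x : A) : ‖p.coeFun x‖ = p.toFun x :=
  UniformSpace.Completion.norm_coe (p.toPre x)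

theorem denseRange_coeFun : DenseRange p.coeFun :=
  UniformSpace.Completion.denseRange_coe (α := p.Pre)

theorem coeFun_add (x y : A) : p.coeFun (x + y) = p.coeFun x + p.coeFun y :=
  UniformSpace.Completion.coe_add (p.toPre x) (p.toPre y)

theorem coeFun_mul (x y : A) : p.coeFun (x * y) = p.coeFun x * p.coeFun y :=
  UniformSpace.Completion.coe_mul (p.toPre x) (p.toPre y)

theorem coeFun_smul (c : ℂ) (x : A) : p.coeFun (c • x) = c • p.coeFun x :=
  UniformSpace.Completion.coe_smul c (p.toPre x)

theorem coeFun_sub (x y : A) : p.coeFun (x - y) = p.coeFun x - p.coeFun y :=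
  UniformSpace.Completion.coe_sub (p.toPre x) (p.toPre y)

theorem coeFun_one : p.coeFun 1 = 1 := rfl

theorem star_isometry : Isometry (fun x : p.Pre => star x) :=
  Isometry.of_dist_eq fun x y => by
    rw [dist_eq_norm, dist_eq_norm, ← star_sub]
    exact p.map_star' (x - y)

/-- The involution of the completion, the continuous extension of the involution of `A`. -/
def starFun (x : p.Compl) : p.Compl :=
  UniformSpace.Completion.map (fun x : p.Pre => star x) x

theorem continuous_starFun : Continuous p.starFun :=
  UniformSpace.Completion.continuous_map

theorem starFun_coeFun (x : A) : p.starFun (p.coeFun x) = p.coeFun (star x) :=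
  UniformSpace.Completion.map_coe p.star_isometry.uniformContinuous _

instance : StarRing p.Compl where
  star := p.starFun
  star_involutive x := by
    refine p.denseRange_coeFun.induction_on x
      (isClosed_eq (p.continuous_starFun.comp p.continuous_starFun) continuous_id) fun a => ?_
    rw [starFun_coeFun, starFun_coeFun, star_star]
  star_mul x y := by
    refine p.denseRange_coeFun.induction_on₂
      (p := fun x y => p.starFun (x * y) = p.starFun y * p.starFun x) ?_ ?_ x y
    · have := p.continuous_starFun
      exact isClosed_eq (by fun_prop) (by fun_prop)
    · intro a b
      simp only [← coeFun_mul, starFun_coeFun, star_mul]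
  star_add x y := by
    refine p.denseRange_coeFun.induction_on₂
      (p := fun x y => p.starFun (x + y) = p.starFun x + p.starFun y) ?_ ?_ x y
    · have := p.continuous_starFun
      exact isClosed_eq (by fun_prop) (by fun_prop)
    · intro a b
      simp only [← coeFun_add, starFun_coeFun, star_add]

theorem continuous_star' : Continuous (star : p.Compl → p.Compl) := p.continuous_starFun

theorem coeFun_star (x : A) : p.coeFun (star x) = star (p.coeFun x) := (p.starFun_coeFun x).symm

instance [StarModule ℂ A] : CStarAlgebra p.Compl where
  norm_mul_self_le x := by
    refine p.denseRange_coeFun.induction_on x ?_ fun a => ?_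
    · exact isClosed_le (continuous_norm.mul continuous_norm)
        (continuous_norm.comp (p.continuous_star'.mul continuous_id))
    · rw [← coeFun_star, ← coeFun_mul, norm_coeFun, norm_coeFun, p.star_mul_self', sq]
  star_smul c x := by
    refine p.denseRange_coeFun.induction_on x ?_ fun a => ?_
    · exact isClosed_eq (p.continuous_star'.comp (continuous_const_smul c))
        (p.continuous_star'.const_smul (star c))
    · rw [← coeFun_star, ← coeFun_smul, ← coeFun_star, ← coeFun_smul, star_smul]

/-- The canonical `*`-homomorphism from `A` to the completion. -/
def coe : A →⋆ₐ[ℂ] p.Compl where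
  toFun := p.coeFun
  map_one' := rfl
  map_mul' := p.coeFun_mul
  map_zero' := rfl
  map_add' := p.coeFun_add
  commutes' c := by
    simp only [Algebra.algebraMap_eq_smul_one, coeFun_smul, coeFun_one]
  map_star' := p.coeFun_star

theorem norm_coe (x : A) : ‖p.coe x‖ = p.toFun x := p.norm_coeFun x

theorem denseRange_coe : DenseRange p.coe := p.denseRange_coeFun

variable [StarModule ℂ A]

/-- A `*`-homomorphism into a C*-algebra that is bounded by `p` extends to the completion. -/
def extend {B : Type u} [CStarAlgebra B] (f : A →⋆ₙₐ[ℂ] B) (hf : ∀ x, ‖f x‖ ≤ p.toFun x) :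
    p.Compl →⋆ₙₐ[ℂ] B :=
  have huc : UniformContinuous (fun x : p.Pre => (f x : B)) :=
    (LipschitzWith.of_dist_le_mul (K := 1) fun x y => by
      rw [dist_eq_norm, dist_eq_norm]
      have h1 := hf (x - y : A)
      rw [NNReal.coe_one, one_mul]
      refine le_trans (le_of_eq ?_) h1
      exact congrArg norm (map_sub f (x : A) (y : A)).symm).uniformContinuous
  let F : p.Compl → B := UniformSpace.Completion.extension (fun x : p.Pre => (f x : B))
  have hF : Continuous F := UniformSpace.Completion.continuous_extension
  have hFc : ∀ x : A, F (p.coeFun x) = f x := fun x =>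
    UniformSpace.Completion.extension_coe huc _
  { toFun := F
    map_smul' := fun c x => by
      refine p.denseRange_coeFun.induction_on x
        (isClosed_eq (hF.comp (continuous_const_smul c)) (hF.const_smul c)) fun a => ?_
      rw [← coeFun_smul, hFc, hFc, map_smul]; rfl
    map_zero' := by
      have := hFc 0
      rwa [map_zero] at this
    map_add' := fun x y => by
      refine p.denseRange_coeFun.induction_on₂ (p := fun x y => F (x + y) = F x + F y)
        (isClosed_eq (hF.comp continuous_add)
          ((hF.comp continuous_fst).add (hF.comp continuous_snd))) (fun a b => ?_) x y
      rw [← coeFun_add, hFc, hFc, hFc, map_add]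
    map_mul' := fun x y => by
      refine p.denseRange_coeFun.induction_on₂ (p := fun x y => F (x * y) = F x * F y)
        (isClosed_eq (hF.comp continuous_mul)
          ((hF.comp continuous_fst).mul (hF.comp continuous_snd))) (fun a b => ?_) x y
      rw [← coeFun_mul, hFc, hFc, hFc, map_mul]
    map_star' := fun x => by
      refine p.denseRange_coeFun.induction_on x
        (isClosed_eq (hF.comp p.continuous_star') (continuous_star.comp hF)) fun a => ?_
      rw [← coeFun_star, hFc, hFc, map_star] }

theorem extend_coe {B : Type u} [CStarAlgebra B] (f : A →⋆ₙₐ[ℂ] B)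
    (hf : ∀ x, ‖f x‖ ≤ p.toFun x) (x : A) : p.extend f hf (p.coe x) = f x := by
  refine UniformSpace.Completion.extension_coe (α := p.Pre) (f := fun x : p.Pre => (f x : B)) ?_ _
  exact (LipschitzWith.of_dist_le_mul (K := 1) fun x y => by
      rw [dist_eq_norm, dist_eq_norm]
      have h1 := hf (x - y : A)
      rw [NNReal.coe_one, one_mul]
      refine le_trans (le_of_eq ?_) h1
      exact congrArg norm (map_sub f (x : A) (y : A)).symm).uniformContinuous

end CStarSeminorm

/-! ### The minimal (spatial) tensor product of C*-algebras -/

namespace MinTensor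

section Rep

variable {A B : Type u} [CStarAlgebra A] [CStarAlgebra B]
variable {H K : Type u} [NormedAddCommGroup H] [InnerProductSpace ℂ H] [CompleteSpace H]
  [NormedAddCommGroup K] [InnerProductSpace ℂ K] [CompleteSpace K]

/-- For representations `π` of `A` on `H` and `σ` of `B` on `K`, the representation `π ⊗ σ` of the
algebraic tensor product of `A` and `B` by bounded operators on the algebraic tensor product
`H ⊗ K` with its Hilbert space inner product; `(π ⊗ σ) (a ⊗ b) = π a ⊗ σ b`. -/
def rep (π : A →⋆ₙₐ[ℂ] (H →L[ℂ] H)) (σ : B →⋆ₙₐ[ℂ] (K →L[ℂ] K)) :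
    A ⊗[ℂ] B →ₗ[ℂ] (H ⊗[ℂ] K →L[ℂ] H ⊗[ℂ] K) :=
  TensorProduct.lift (LinearMap.mk₂ ℂ (fun a b => TensorProduct.mapL (π a) (σ b))
    (fun a a' b => by rw [map_add, TensorProduct.mapL_add_left])
    (fun c a b => by rw [map_smul, TensorProduct.mapL_smul_left])
    (fun a b b' => by rw [map_add, TensorProduct.mapL_add_right])
    (fun c a b => by rw [map_smul, TensorProduct.mapL_smul_right]))

theorem rep_tmul (π : A →⋆ₙₐ[ℂ] (H →L[ℂ] H)) (σ : B →⋆ₙₐ[ℂ] (K →L[ℂ] K)) (a : A) (b : B) :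
    rep π σ (a ⊗ₜ b) = TensorProduct.mapL (π a) (σ b) := rfl

theorem rep_mul (π : A →⋆ₙₐ[ℂ] (H →L[ℂ] H)) (σ : B →⋆ₙₐ[ℂ] (K →L[ℂ] K)) (x y : A ⊗[ℂ] B) :
    rep π σ (x * y) = rep π σ x * rep π σ y := by
  induction x using TensorProduct.induction_on with
  | zero => rw [zero_mul, map_zero, zero_mul]
  | add x₁ x₂ h₁ h₂ => rw [add_mul, map_add, map_add, add_mul, h₁, h₂]
  | tmul a b =>
    induction y using TensorProduct.induction_on with
    | zero => rw [mul_zero, map_zero, mul_zero]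
    | add y₁ y₂ h₁ h₂ => rw [mul_add, map_add, map_add, mul_add, h₁, h₂]
    | tmul a' b' =>
      rw [Algebra.TensorProduct.tmul_mul_tmul, rep_tmul, rep_tmul, rep_tmul, map_mul, map_mul,
        TensorProduct.mapL_mul]

theorem inner_rep_star (π : A →⋆ₙₐ[ℂ] (H →L[ℂ] H)) (σ : B →⋆ₙₐ[ℂ] (K →L[ℂ] K)) (x : A ⊗[ℂ] B)
    (ξ η : H ⊗[ℂ] K) : inner ℂ (rep π σ (star x) ξ) η = inner ℂ ξ (rep π σ x η) := by
  induction x using TensorProduct.induction_on with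
  | zero => simp
  | add x₁ x₂ h₁ h₂ =>
    rw [star_add, map_add, map_add, _root_.add_apply, _root_.add_apply,
      inner_add_left, inner_add_right, h₁, h₂]
  | tmul a b =>
    rw [TensorProduct.star_tmul, rep_tmul, rep_tmul, map_star, map_star]
    induction ξ using TensorProduct.induction_on with
    | zero => simp
    | add ξ₁ ξ₂ h₁ h₂ => rw [map_add, inner_add_left, inner_add_left, h₁, h₂]
    | tmul ξ ξ' =>
      induction η using TensorProduct.induction_on with
      | zero => simp
      | add η₁ η₂ h₁ h₂ => rw [map_add, inner_add_right, inner_add_right, h₁, h₂]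
      | tmul η η' =>
        rw [TensorProduct.mapL_tmul, TensorProduct.mapL_tmul, TensorProduct.inner_tmul,
          TensorProduct.inner_tmul, ContinuousLinearMap.star_eq_adjoint,
          ContinuousLinearMap.star_eq_adjoint, ContinuousLinearMap.adjoint_inner_left,
          ContinuousLinearMap.adjoint_inner_left]

/-- The C*-seminorm `x ↦ ‖(π ⊗ σ) x‖` on the algebraic tensor product. -/
def repSeminorm (π : A →⋆ₙₐ[ℂ] (H →L[ℂ] H)) (σ : B →⋆ₙₐ[ℂ] (K →L[ℂ] K)) :
    CStarSeminorm (A ⊗[ℂ] B) :=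
  CStarSeminorm.ofOperators (E := H ⊗[ℂ] K) (rep π σ) (rep_mul π σ) (inner_rep_star π σ)

theorem repSeminorm_apply (π : A →⋆ₙₐ[ℂ] (H →L[ℂ] H)) (σ : B →⋆ₙₐ[ℂ] (K →L[ℂ] K))
    (x : A ⊗[ℂ] B) : (repSeminorm π σ).toFun x = ‖rep π σ x‖ := rfl

end Rep

variable (A B : Type u) [CStarAlgebra A] [CStarAlgebra B]

/-- The set of all seminorms `x ↦ ‖(π ⊗ σ) x‖`, where `π` and `σ` run through the
`*`-representations of `A` and of `B` on Hilbert spaces. -/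
def repSeminorms : Set (CStarSeminorm (A ⊗[ℂ] B)) :=
  {p | ∃ (H K : Type u) (_ : NormedAddCommGroup H) (_ : InnerProductSpace ℂ H)
    (_ : CompleteSpace H) (_ : NormedAddCommGroup K) (_ : InnerProductSpace ℂ K)
    (_ : CompleteSpace K) (π : A →⋆ₙₐ[ℂ] (H →L[ℂ] H)) (σ : B →⋆ₙₐ[ℂ] (K →L[ℂ] K)),
    p = repSeminorm π σ}

theorem repSeminorms_bdd (x : A ⊗[ℂ] B) : ∃ C : ℝ, ∀ p ∈ repSeminorms A B, p.toFun x ≤ C := by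
  induction x using TensorProduct.induction_on with
  | zero => exact ⟨0, fun p _ => p.map_zero'.le⟩
  | add x y hx hy =>
    obtain ⟨C, hC⟩ := hx
    obtain ⟨D, hD⟩ := hy
    exact ⟨C + D, fun p hp => (p.add_le' x y).trans (add_le_add (hC p hp) (hD p hp))⟩
  | tmul a b =>
    refine ⟨‖a‖ * ‖b‖, ?_⟩
    rintro _ ⟨H, K, _, _, _, _, _, _, π, σ, rfl⟩
    rw [repSeminorm_apply, rep_tmul]
    refine (TensorProduct.norm_mapL_le (π a) (σ b)).trans ?_
    exact mul_le_mul (NonUnitalStarAlgHom.norm_apply_le π a)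
      (NonUnitalStarAlgHom.norm_apply_le σ b) (norm_nonneg _) (norm_nonneg _)

/-- The minimal (spatial) C*-norm: the supremum of `‖(π ⊗ σ) x‖` over all pairs of
`*`-representations. -/
def minNorm : CStarSeminorm (A ⊗[ℂ] B) := .sup (repSeminorms A B) (repSeminorms_bdd A B)

end MinTensor

/-- The minimal tensor product of two C*-algebras: the completion of the algebraic tensor product
with respect to the minimal C*-norm. -/
def MinTensor (A B : Type u) [CStarAlgebra A] [CStarAlgebra B] : Type u :=
  (MinTensor.minNorm A B).Compl

namespace MinTensor

variable {A B C D : Type u} [CStarAlgebra A] [CStarAlgebra B] [CStarAlgebra C] [CStarAlgebra D]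

instance : CStarAlgebra (MinTensor A B) :=
  inferInstanceAs (CStarAlgebra (MinTensor.minNorm A B).Compl)

/-- The canonical map from the algebraic to the minimal tensor product. -/
def ofAlg : A ⊗[ℂ] B →⋆ₐ[ℂ] MinTensor A B := (MinTensor.minNorm A B).coe

theorem denseRange_ofAlg : DenseRange (ofAlg : A ⊗[ℂ] B →⋆ₐ[ℂ] MinTensor A B) :=
  (MinTensor.minNorm A B).denseRange_coe

/-- The elementary tensor `a ⊗ b` in the minimal tensor product. -/
def tmul (a : A) (b : B) : MinTensor A B := ofAlg (a ⊗ₜ[ℂ] b)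

/-- The algebraic tensor product of two `*`-homomorphisms. -/
def algMap (φ : A →⋆ₙₐ[ℂ] C) (ψ : B →⋆ₙₐ[ℂ] D) : A ⊗[ℂ] B →⋆ₙₐ[ℂ] C ⊗[ℂ] D :=
  { TensorProduct.map (φ : A →ₗ[ℂ] C) (ψ : B →ₗ[ℂ] D) with
    map_zero' := map_zero (TensorProduct.map (φ : A →ₗ[ℂ] C) (ψ : B →ₗ[ℂ] D))
    map_mul' := fun x y => by
      change TensorProduct.map (φ : A →ₗ[ℂ] C) (ψ : B →ₗ[ℂ] D) (x * y) =
        TensorProduct.map (φ : A →ₗ[ℂ] C) (ψ : B →ₗ[ℂ] D) x *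
        TensorProduct.map (φ : A →ₗ[ℂ] C) (ψ : B →ₗ[ℂ] D) y
      induction x using TensorProduct.induction_on with
      | zero => rw [zero_mul, map_zero, zero_mul]
      | add x₁ x₂ h₁ h₂ => rw [add_mul, map_add, map_add, add_mul, h₁, h₂]
      | tmul a b =>
        induction y using TensorProduct.induction_on with
        | zero => rw [mul_zero, map_zero, mul_zero]
        | add y₁ y₂ h₁ h₂ => rw [mul_add, map_add, map_add, mul_add, h₁, h₂]
        | tmul a' b' =>
          rw [Algebra.TensorProduct.tmul_mul_tmul, TensorProduct.map_tmul, TensorProduct.map_tmul,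
            TensorProduct.map_tmul, Algebra.TensorProduct.tmul_mul_tmul]
          exact congrArg₂ _ (map_mul φ a a') (map_mul ψ b b')
    map_star' := fun x => by
      change TensorProduct.map (φ : A →ₗ[ℂ] C) (ψ : B →ₗ[ℂ] D) (star x) =
        star (TensorProduct.map (φ : A →ₗ[ℂ] C) (ψ : B →ₗ[ℂ] D) x)
      induction x using TensorProduct.induction_on with
      | zero => rw [star_zero, map_zero, star_zero]
      | add x₁ x₂ h₁ h₂ => rw [star_add, map_add, map_add, star_add, h₁, h₂]
      | tmul a b =>
        rw [TensorProduct.star_tmul, TensorProduct.map_tmul, TensorProduct.map_tmul,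
          TensorProduct.star_tmul]
        exact congrArg₂ _ (map_star φ a) (map_star ψ b) }

theorem algMap_tmul (φ : A →⋆ₙₐ[ℂ] C) (ψ : B →⋆ₙₐ[ℂ] D) (a : A) (b : B) :
    algMap φ ψ (a ⊗ₜ b) = φ a ⊗ₜ ψ b := rfl

theorem rep_algMap {H K : Type u} [NormedAddCommGroup H] [InnerProductSpace ℂ H] [CompleteSpace H]
    [NormedAddCommGroup K] [InnerProductSpace ℂ K] [CompleteSpace K]
    (π : C →⋆ₙₐ[ℂ] (H →L[ℂ] H)) (σ : D →⋆ₙₐ[ℂ] (K →L[ℂ] K))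
    (φ : A →⋆ₙₐ[ℂ] C) (ψ : B →⋆ₙₐ[ℂ] D) (x : A ⊗[ℂ] B) :
    rep π σ (algMap φ ψ x) = rep (π.comp φ) (σ.comp ψ) x := by
  induction x using TensorProduct.induction_on with
  | zero => rw [map_zero, map_zero, map_zero]
  | add x y hx hy => rw [map_add, map_add, map_add, hx, hy]
  | tmul a b => rfl

theorem minNorm_algMap_le (φ : A →⋆ₙₐ[ℂ] C) (ψ : B →⋆ₙₐ[ℂ] D) (x : A ⊗[ℂ] B) :
    (minNorm C D).toFun (algMap φ ψ x) ≤ (minNorm A B).toFun x := by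
  refine CStarSeminorm.sup_le _ _ _ ((minNorm A B).nonneg' x) ?_
  rintro _ ⟨H, K, _, _, _, _, _, _, π, σ, rfl⟩
  refine le_trans (le_of_eq ?_) (CStarSeminorm.le_sup (repSeminorms A B) (repSeminorms_bdd A B)
    ⟨H, K, _, _, _, _, _, _, π.comp φ, σ.comp ψ, rfl⟩ x)
  rw [repSeminorm_apply, repSeminorm_apply, rep_algMap]

/-- The tensor product `φ ⊗ ψ` of two (not necessarily unital) `*`-homomorphisms. -/
def map (φ : A →⋆ₙₐ[ℂ] C) (ψ : B →⋆ₙₐ[ℂ] D) : MinTensor A B →⋆ₙₐ[ℂ] MinTensor C D :=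
  (minNorm A B).extend (((ofAlg : C ⊗[ℂ] D →⋆ₐ[ℂ] MinTensor C D) :
      C ⊗[ℂ] D →⋆ₙₐ[ℂ] MinTensor C D).comp (algMap φ ψ))
    fun x => ((minNorm C D).norm_coe _).le.trans (minNorm_algMap_le φ ψ x)

theorem map_ofAlg (φ : A →⋆ₙₐ[ℂ] C) (ψ : B →⋆ₙₐ[ℂ] D) (x : A ⊗[ℂ] B) :
    map φ ψ (ofAlg x) = ofAlg (algMap φ ψ x) := (minNorm A B).extend_coe _ _ x

theorem continuous_map (φ : A →⋆ₙₐ[ℂ] C) (ψ : B →⋆ₙₐ[ℂ] D) : Continuous (map φ ψ) :=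
  AddMonoidHomClass.continuous_of_bound (map φ ψ) 1 fun x => by
    rw [one_mul]; exact NonUnitalStarAlgHom.norm_apply_le (map φ ψ) x

theorem map_tmul (φ : A →⋆ₙₐ[ℂ] C) (ψ : B →⋆ₙₐ[ℂ] D) (a : A) (b : B) :
    map φ ψ (tmul a b) = tmul (φ a) (ψ b) := map_ofAlg φ ψ _

theorem tmul_mul_tmul (a a' : A) (b b' : B) : tmul a b * tmul a' b' = tmul (a * a') (b * b') := by
  rw [tmul, tmul, ← map_mul, Algebra.TensorProduct.tmul_mul_tmul]; rfl

theorem star_tmul (a : A) (b : B) : star (tmul a b) = tmul (star a) (star b) := by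
  rw [tmul, ← map_star, TensorProduct.star_tmul]; rfl

theorem one_def : (1 : MinTensor A B) = tmul 1 1 := (map_one ofAlg).symm

/-- `x` and `y` correspond to each other under the canonical isomorphism of `(A ⊗ B) ⊗ C` with
`A ⊗ (B ⊗ C)`. This isomorphism is isometric for the minimal norms, so that its graph is the closure
of the graph of the associativity isomorphism of the algebraic tensor products. -/
def AssocRel (x : MinTensor (MinTensor A B) C) (y : MinTensor A (MinTensor B C)) : Prop :=
  (x, y) ∈ closure (Set.range fun t : (A ⊗[ℂ] B) ⊗[ℂ] C =>
    ((ofAlg (TensorProduct.map (ofAlg : A ⊗[ℂ] B →⋆ₐ[ℂ] MinTensor A B).toAlgHom.toLinearMap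
        (LinearMap.id : C →ₗ[ℂ] C) t) : MinTensor (MinTensor A B) C),
     (ofAlg (TensorProduct.map (LinearMap.id : A →ₗ[ℂ] A)
        (ofAlg : B ⊗[ℂ] C →⋆ₐ[ℂ] MinTensor B C).toAlgHom.toLinearMap
        (TensorProduct.assoc ℂ A B C t)) : MinTensor A (MinTensor B C))))

/-- `b` is the slice `(θ ⊗ id) x` of `x` by the bounded functional `θ`. The slice map of `θ` is
bounded for the minimal norm, so that its graph is the closure of the graph of the map
`a ⊗ b ↦ θ a • b` on the algebraic tensor product. -/
def IsSlice (θ : A →L[ℂ] ℂ) (x : MinTensor A B) (b : B) : Prop :=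
  (x, b) ∈ closure (Set.range fun t : A ⊗[ℂ] B =>
    ((ofAlg t : MinTensor A B),
      TensorProduct.lid ℂ B (TensorProduct.map (θ : A →ₗ[ℂ] ℂ) LinearMap.id t)))

end MinTensor

/-! ### Universal C*-algebras given by generators and relations -/

/-- The free complex unital `*`-algebra on a set `X`, realised as the free algebra on the symbols
`x` (left summand) and `x*` (right summand). -/
def FreeStar (X : Type u) : Type u := FreeAlgebra ℂ (X ⊕ X)

namespace FreeStar

variable {X : Type u}

instance : Ring (FreeStar X) := inferInstanceAs (Ring (FreeAlgebra ℂ (X ⊕ X)))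
instance : Algebra ℂ (FreeStar X) := inferInstanceAs (Algebra ℂ (FreeAlgebra ℂ (X ⊕ X)))

/-- The generator corresponding to a symbol. -/
def sym (x : X ⊕ X) : FreeStar X := FreeAlgebra.ι ℂ x

/-- The generator corresponding to `x`. -/
def gen (x : X) : FreeStar X := sym (Sum.inl x)

theorem induction {P : FreeStar X → Prop} (h0 : ∀ c : ℂ, P (algebraMap ℂ _ c))
    (h1 : ∀ x, P (sym x)) (h2 : ∀ a b, P a → P b → P (a * b)) (h3 : ∀ a b, P a → P b → P (a + b))
    (a : FreeStar X) : P a := FreeAlgebra.induction ℂ (X ⊕ X) h0 h1 h2 h3 a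

/-- The algebra structure on the opposite algebra in which scalars act through their conjugates. -/
@[reducible] def conjOpAlgebra : Algebra ℂ (FreeStar X)ᵐᵒᵖ :=
  RingHom.toAlgebra' ((algebraMap ℂ (FreeStar X)ᵐᵒᵖ).comp (starRingEnd ℂ))
    fun c x => Algebra.commutes (starRingEnd ℂ c) x

/-- The involution of the free `*`-algebra, as a ring homomorphism into the opposite ring. -/
def starHom : FreeStar X →+* (FreeStar X)ᵐᵒᵖ :=
  letI : Algebra ℂ (FreeStar X)ᵐᵒᵖ := conjOpAlgebra
  (FreeAlgebra.lift ℂ (fun x : X ⊕ X => MulOpposite.op (sym x.swap)) :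
    FreeAlgebra ℂ (X ⊕ X) →ₐ[ℂ] (FreeStar X)ᵐᵒᵖ).toRingHom

theorem starHom_sym (x : X ⊕ X) : starHom (sym x) = MulOpposite.op (sym x.swap) :=
  letI : Algebra ℂ (FreeStar X)ᵐᵒᵖ := conjOpAlgebra
  FreeAlgebra.lift_ι_apply (R := ℂ) (fun x : X ⊕ X => MulOpposite.op (sym x.swap)) x

theorem starHom_algebraMap (c : ℂ) : starHom (algebraMap ℂ (FreeStar X) c) =
    MulOpposite.op (algebraMap ℂ (FreeStar X) (starRingEnd ℂ c)) :=
  letI : Algebra ℂ (FreeStar X)ᵐᵒᵖ := conjOpAlgebra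
  AlgHom.commutes (FreeAlgebra.lift ℂ (fun x : X ⊕ X => MulOpposite.op (sym x.swap)) :
    FreeAlgebra ℂ (X ⊕ X) →ₐ[ℂ] (FreeStar X)ᵐᵒᵖ) c

instance : StarRing (FreeStar X) where
  star a := (starHom a).unop
  star_involutive a := by
    refine induction (P := fun a => (starHom (starHom a).unop).unop = a) ?_ ?_ ?_ ?_ a
    · intro c; simp [starHom_algebraMap]
    · intro x; simp [starHom_sym]
    · intro a b ha hb; simp [ha, hb]
    · intro a b ha hb; simp [ha, hb]
  star_mul a b := by simp
  star_add a b := by simp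

theorem star_sym (x : X ⊕ X) : star (sym x) = sym x.swap :=
  congrArg MulOpposite.unop (starHom_sym x)

theorem star_algebraMap (c : ℂ) :
    star (algebraMap ℂ (FreeStar X) c) = algebraMap ℂ (FreeStar X) (starRingEnd ℂ c) :=
  congrArg MulOpposite.unop (starHom_algebraMap c)

instance : StarModule ℂ (FreeStar X) where
  star_smul c a := by
    rw [Algebra.smul_def, star_mul, star_algebraMap, Algebra.smul_def, Algebra.commutes]; rfl

/-- The `*`-homomorphism from the free `*`-algebra with given values on the generators. -/
def lift {B : Type u} [CStarAlgebra B] (f : X → B) : FreeStar X →⋆ₐ[ℂ] B :=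
  let F : FreeAlgebra ℂ (X ⊕ X) →ₐ[ℂ] B := FreeAlgebra.lift ℂ (Sum.elim f fun x => star (f x))
  have hF : ∀ x, F (FreeAlgebra.ι ℂ x) = Sum.elim f (fun x => star (f x)) x := fun x =>
    FreeAlgebra.lift_ι_apply (R := ℂ) _ x
  { (F : FreeStar X →ₐ[ℂ] B) with
    map_star' := fun a => by
      change F (star a : FreeStar X) = star (F a)
      refine induction (P := fun a => F (star a : FreeStar X) = star (F a)) ?_ ?_ ?_ ?_ a
      · intro c
        rw [star_algebraMap]
        refine (AlgHom.commutes F _).trans ?_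
        refine Eq.trans ?_ (congrArg star (AlgHom.commutes F c)).symm
        exact algebraMap_star_comm c
      · intro x
        rw [star_sym]
        refine (hF _).trans (Eq.trans ?_ (congrArg star (hF x)).symm)
        cases x <;> simp
      · intro a b ha hb
        rw [star_mul]
        refine (map_mul F _ _).trans (Eq.trans ?_ (congrArg star (map_mul F a b)).symm)
        rw [star_mul, ha, hb]; rfl
      · intro a b ha hb
        rw [star_add]
        refine (map_add F _ _).trans (Eq.trans ?_ (congrArg star (map_add F a b)).symm)
        rw [star_add, ha, hb]; rfl }

theorem lift_gen {B : Type u} [CStarAlgebra B] (f : X → B) (x : X) : lift f (gen x) = f x :=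
  FreeAlgebra.lift_ι_apply (R := ℂ) (Sum.elim f fun x => star (f x)) (Sum.inl x)

theorem lift_sym {B : Type u} [CStarAlgebra B] (f : X → B) (x : X ⊕ X) :
    lift f (sym x) = Sum.elim f (fun x => star (f x)) x :=
  FreeAlgebra.lift_ι_apply (R := ℂ) (Sum.elim f fun x => star (f x)) x

end FreeStar

/-- A set of relations on generators `X`, given by saying which families in C*-algebras satisfy
them. The generators are required to be contractions in all these families. -/
structure CStarRelations (X : Type u) where
  holds : ∀ (B : Type u) [CStarAlgebra B], (X → B) → Prop
  norm_le : ∀ (B : Type u) [CStarAlgebra B] (f : X → B), holds B f → ∀ x, ‖f x‖ ≤ 1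

namespace CStarRelations

variable {X : Type u} (R : CStarRelations X)

/-- The set of all C*-seminorms `a ↦ ‖lift f a‖`, where `f` runs through the families satisfying
the relations. -/
def seminorms : Set (CStarSeminorm (FreeStar X)) :=
  {p | ∃ (B : Type u) (_ : CStarAlgebra B) (f : X → B), R.holds B f ∧
    ∀ a, p.toFun a = ‖FreeStar.lift f a‖}

theorem seminorms_bdd (a : FreeStar X) : ∃ C : ℝ, ∀ p ∈ R.seminorms, p.toFun a ≤ C := by
  have key : ∃ C : ℝ, 0 ≤ C ∧ ∀ p ∈ R.seminorms, p.toFun a ≤ C := by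
    refine FreeStar.induction (P := fun a => ∃ C : ℝ, 0 ≤ C ∧ ∀ p ∈ R.seminorms, p.toFun a ≤ C)
      ?_ ?_ ?_ ?_ a
    · intro c
      refine ⟨‖c‖ * 1, by positivity, ?_⟩
      rintro p ⟨B, _, f, hf, hp⟩
      rw [hp, Algebra.algebraMap_eq_smul_one, map_smul, map_one, norm_smul]
      refine mul_le_mul_of_nonneg_left ?_ (norm_nonneg c)
      rcases subsingleton_or_nontrivial B with h | h
      · rw [Subsingleton.elim (1 : B) 0, norm_zero]; exact zero_le_one
      · exact CStarRing.norm_one.le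
    · intro x
      refine ⟨1, zero_le_one, ?_⟩
      rintro p ⟨B, _, f, hf, hp⟩
      rw [hp, FreeStar.lift_sym]
      rcases x with x | x
      · exact R.norm_le B f hf x
      · exact (norm_star (f x)).le.trans (R.norm_le B f hf x)
    · rintro a b ⟨C, hC0, hC⟩ ⟨D, hD0, hD⟩
      exact ⟨C * D, mul_nonneg hC0 hD0, fun p hp => (p.mul_le' a b).trans
        (mul_le_mul (hC p hp) (hD p hp) (p.nonneg' b) hC0)⟩
    · rintro a b ⟨C, hC0, hC⟩ ⟨D, hD0, hD⟩
      exact ⟨C + D, add_nonneg hC0 hD0, fun p hp => (p.add_le' a b).trans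
        (add_le_add (hC p hp) (hD p hp))⟩
  obtain ⟨C, _, hC⟩ := key
  exact ⟨C, hC⟩

/-- The universal C*-algebra on the generators `X` with the relations `R`: the completion of the
free `*`-algebra with respect to the largest C*-seminorm coming from a family satisfying `R`. -/
def Univ : Type u := (CStarSeminorm.sup R.seminorms R.seminorms_bdd).Compl

instance : CStarAlgebra R.Univ :=
  inferInstanceAs (CStarAlgebra (CStarSeminorm.sup R.seminorms R.seminorms_bdd).Compl)

/-- The canonical map from the free `*`-algebra. -/
def ofFree : FreeStar X →⋆ₐ[ℂ] R.Univ := (CStarSeminorm.sup R.seminorms R.seminorms_bdd).coe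

/-- The canonical generators of the universal C*-algebra. -/
def gen (x : X) : R.Univ := R.ofFree (FreeStar.gen x)

theorem denseRange_mk : DenseRange R.ofFree :=
  (CStarSeminorm.sup R.seminorms R.seminorms_bdd).denseRange_coe

/-- An identity that holds in all families satisfying the relations holds for the generators. -/
theorem ofFree_eq_of_forall (a b : FreeStar X) (h : ∀ (B : Type u) [CStarAlgebra B] (f : X → B),
    R.holds B f → FreeStar.lift f a = FreeStar.lift f b) : R.ofFree a = R.ofFree b := by
  rw [← sub_eq_zero, ← map_sub, ← norm_le_zero_iff]
  refine ((CStarSeminorm.sup R.seminorms R.seminorms_bdd).norm_coe _).le.trans ?_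
  refine CStarSeminorm.sup_le _ _ _ le_rfl ?_
  rintro p ⟨B, _, f, hf, hp⟩
  rw [hp, map_sub, h B f hf, sub_self, norm_zero]

theorem lift_le {B : Type u} [CStarAlgebra B] (f : X → B) (hf : R.holds B f) (a : FreeStar X) :
    ‖FreeStar.lift f a‖ ≤ (CStarSeminorm.sup R.seminorms R.seminorms_bdd).toFun a :=
  (CStarSeminorm.le_sup R.seminorms R.seminorms_bdd
    (p := { toFun := fun a => ‖FreeStar.lift f a‖
            nonneg' := fun a => norm_nonneg _
            add_le' := fun a b => by rw [map_add]; exact norm_add_le _ _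
            smul' := fun c a => by rw [map_smul, norm_smul]
            mul_le' := fun a b => by rw [map_mul]; exact norm_mul_le _ _
            star_mul_self' := fun a => by
              rw [map_mul, map_star, CStarRing.norm_star_mul_self, sq] })
    ⟨B, inferInstance, f, hf, fun _ => rfl⟩ a)

/-- The universal property: a family satisfying the relations induces a `*`-homomorphism. -/
def lift {B : Type u} [CStarAlgebra B] (f : X → B) (hf : R.holds B f) : R.Univ →⋆ₐ[ℂ] B :=
  let F : R.Univ →⋆ₙₐ[ℂ] B := (CStarSeminorm.sup R.seminorms R.seminorms_bdd).extend
    (FreeStar.lift f : FreeStar X →⋆ₙₐ[ℂ] B) (R.lift_le f hf)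
  have h1 : F 1 = 1 := ((CStarSeminorm.sup R.seminorms R.seminorms_bdd).extend_coe
    (FreeStar.lift f : FreeStar X →⋆ₙₐ[ℂ] B) (R.lift_le f hf) 1).trans (map_one (FreeStar.lift f))
  { toFun := F
    map_one' := h1
    map_mul' := map_mul F
    map_zero' := map_zero F
    map_add' := map_add F
    commutes' := fun c => by
      rw [Algebra.algebraMap_eq_smul_one, Algebra.algebraMap_eq_smul_one, map_smul, h1]
    map_star' := map_star F }

theorem lift_gen {B : Type u} [CStarAlgebra B] (f : X → B) (hf : R.holds B f) (x : X) :
    R.lift f hf (R.gen x) = f x :=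
  ((CStarSeminorm.sup R.seminorms R.seminorms_bdd).extend_coe
    (FreeStar.lift f : FreeStar X →⋆ₙₐ[ℂ] B) (R.lift_le f hf) (FreeStar.gen x)).trans
    (FreeStar.lift_gen f x)

end CStarRelations

/-! ### Directed graphs and their C*-algebras -/

/-- A directed graph, possibly with loops and multiple edges, with vertex set `V` and edge set `E`:
the source and the range map. -/
structure DirectedGraph (V E : Type u) where
  s : E → V
  r : E → V

theorem CStarAlgebra.norm_le_one_of_projection {B : Type u} [CStarAlgebra B] {p : B}
    (h : star p = p) (h' : p * p = p) : ‖p‖ ≤ 1 := by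
  have h2 : ‖p‖ = ‖p‖ * ‖p‖ := by
    rw [← CStarRing.norm_star_mul_self, h, h']
  rcases (norm_nonneg p).eq_or_lt with h0 | h0
  · rw [← h0]; exact zero_le_one
  · nlinarith

namespace DirectedGraph

variable {V E : Type u} (Γ : DirectedGraph V E)

/-- Every vertex is the source or the range of some edge. -/
def IsConnected : Prop := ∀ v, (∃ e, Γ.s e = v) ∨ (∃ e, Γ.r e = v)

/-- Condition (R3): given any two (possibly equal) vertices, there is at most one edge from the
first to the second. -/
def SatisfiesR3 : Prop := ∀ e f, Γ.s e = Γ.s f → Γ.r e = Γ.r f → e = f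

variable [Fintype V] [Fintype E]

open Classical in
/-- A Cuntz-Krieger `Γ`-family in a unital C*-algebra: mutually orthogonal projections `p v` with sum
`1` (the unit of the graph C*-algebra) and partial isometries `S e` with `S e* S e = p (r e)` and
`p v = ∑ S f S f*`, where `f` runs through the edges with source `v`, whenever `v` emits an edge. -/
structure IsCKFamily {B : Type u} [CStarAlgebra B] (p : V → B) (S : E → B) : Prop where
  star_p : ∀ v, star (p v) = p v
  p_mul_p : ∀ v w, p v * p w = if v = w then p v else 0
  sum_p : ∑ v, p v = 1
  partialIsometry : ∀ e, S e * star (S e) * S e = S e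
  star_S_mul_S : ∀ e, star (S e) * S e = p (Γ.r e)
  sum_S_mul_star : ∀ v, (∃ e, Γ.s e = v) →
    p v = ∑ f ∈ Finset.univ.filter (fun f => Γ.s f = v), S f * star (S f)

/-- The relations defining the graph C*-algebra, on the generators `p v` and `S e`. -/
def ckRelations : CStarRelations (V ⊕ E) where
  holds _ _ f := Γ.IsCKFamily (fun v => f (Sum.inl v)) (fun e => f (Sum.inr e))
  norm_le B _ f hf x := by
    have hp : ∀ v, ‖f (Sum.inl v)‖ ≤ 1 := fun v =>
      CStarAlgebra.norm_le_one_of_projection (hf.star_p v)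
        ((hf.p_mul_p v v).trans (if_pos rfl))
    rcases x with v | e
    · exact hp v
    · have h := hp (Γ.r e)
      rw [← hf.star_S_mul_S e, CStarRing.norm_star_mul_self] at h
      nlinarith [norm_nonneg (f (Sum.inr e))]

/-- The graph C*-algebra of `Γ`. -/
abbrev CStar : Type u := Γ.ckRelations.Univ

/-- The canonical projections of the graph C*-algebra. -/
def p (v : V) : Γ.CStar := Γ.ckRelations.gen (Sum.inl v)

/-- The canonical partial isometries of the graph C*-algebra. -/
def S (e : E) : Γ.CStar := Γ.ckRelations.gen (Sum.inr e)

end DirectedGraph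

/-! ### Compact quantum groups -/

section QuantumGroups

variable {Q Q' C : Type u} [CStarAlgebra Q] [CStarAlgebra Q'] [CStarAlgebra C]

/-- `(Q, Δ)` is a compact quantum group: `(id ⊗ Δ) Δ = (Δ ⊗ id) Δ`, and the linear spans of
`Δ(Q)(1 ⊗ Q)` and of `Δ(Q)(Q ⊗ 1)` are dense. -/
structure IsCompactQuantumGroup (Δ : Q →⋆ₐ[ℂ] MinTensor Q Q) : Prop where
  coassoc : ∀ a, MinTensor.AssocRel
    (MinTensor.map (Δ : Q →⋆ₙₐ[ℂ] MinTensor Q Q) (NonUnitalStarAlgHom.id ℂ Q) (Δ a))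
    (MinTensor.map (NonUnitalStarAlgHom.id ℂ Q) (Δ : Q →⋆ₙₐ[ℂ] MinTensor Q Q) (Δ a))
  dense_right : Dense (Submodule.span ℂ
    {x : MinTensor Q Q | ∃ a b : Q, x = Δ a * MinTensor.tmul 1 b} : Set (MinTensor Q Q))
  dense_left : Dense (Submodule.span ℂ
    {x : MinTensor Q Q | ∃ a b : Q, x = Δ a * MinTensor.tmul b 1} : Set (MinTensor Q Q))

/-- `φ` is a morphism of compact quantum groups: `(φ ⊗ φ) Δ = Δ' φ`. -/
def IsCQGMorphism (Δ : Q →⋆ₐ[ℂ] MinTensor Q Q) (Δ' : Q' →⋆ₐ[ℂ] MinTensor Q' Q')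
    (φ : Q →⋆ₐ[ℂ] Q') : Prop :=
  ∀ a, MinTensor.map (φ : Q →⋆ₙₐ[ℂ] Q') (φ : Q →⋆ₙₐ[ℂ] Q') (Δ a) = Δ' (φ a)

/-- `(Q, Δ)` and `(Q', Δ')` are isomorphic compact quantum groups. -/
def AreIsomorphicCQG (Δ : Q →⋆ₐ[ℂ] MinTensor Q Q) (Δ' : Q' →⋆ₐ[ℂ] MinTensor Q' Q') : Prop :=
  ∃ ψ : Q ≃⋆ₐ[ℂ] Q', IsCQGMorphism Δ Δ' (ψ : Q →⋆ₐ[ℂ] Q')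

/-- `α` is a faithful action of the compact quantum group `(Q, Δ)` on the C*-algebra `C`. -/
structure IsFaithfulAction (Δ : Q →⋆ₐ[ℂ] MinTensor Q Q) (α : C →⋆ₐ[ℂ] MinTensor C Q) : Prop where
  coaction : ∀ x, MinTensor.AssocRel
    (MinTensor.map (α : C →⋆ₙₐ[ℂ] MinTensor C Q) (NonUnitalStarAlgHom.id ℂ Q) (α x))
    (MinTensor.map (NonUnitalStarAlgHom.id ℂ C) (Δ : Q →⋆ₙₐ[ℂ] MinTensor Q Q) (α x))
  dense : Dense (Submodule.span ℂ
    {y : MinTensor C Q | ∃ (x : C) (b : Q), y = α x * MinTensor.tmul 1 b} : Set (MinTensor C Q))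
  faithful : Dense (StarAlgebra.adjoin ℂ
    {b : Q | ∃ (θ : C →L[ℂ] ℂ) (x : C), MinTensor.IsSlice θ (α x) b} : Set Q)

/-! The doubling of a compact quantum group -/

/-- The first embedding `ζ a = (a, 0)` of `Q` into `Q ⊕ Q`. -/
def zetaHom (Q : Type u) [CStarAlgebra Q] : Q →⋆ₙₐ[ℂ] Q × Q where
  toFun a := (a, 0)
  map_smul' c a := by simp
  map_zero' := rfl
  map_add' a b := by simp
  map_mul' a b := by simp
  map_star' a := by simp [Prod.ext_iff]

/-- The second embedding `η a = (0, a)` of `Q` into `Q ⊕ Q`. -/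
def etaHom (Q : Type u) [CStarAlgebra Q] : Q →⋆ₙₐ[ℂ] Q × Q where
  toFun a := (0, a)
  map_smul' c a := by simp
  map_zero' := rfl
  map_add' a b := by simp
  map_mul' a b := by simp
  map_star' a := by simp [Prod.ext_iff]

theorem MinTensor.map_mul_map_eq_zero {A₁ A₂ B₁ B₂ D₁ D₂ : Type u} [CStarAlgebra A₁]
    [CStarAlgebra A₂] [CStarAlgebra B₁] [CStarAlgebra B₂] [CStarAlgebra D₁] [CStarAlgebra D₂]
    (f : A₁ →⋆ₙₐ[ℂ] D₁) (g : B₁ →⋆ₙₐ[ℂ] D₂) (f' : A₂ →⋆ₙₐ[ℂ] D₁) (g' : B₂ →⋆ₙₐ[ℂ] D₂)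
    (h : (∀ a a', f a * f' a' = 0) ∨ (∀ b b', g b * g' b' = 0))
    (x : MinTensor A₁ B₁) (y : MinTensor A₂ B₂) :
    MinTensor.map f g x * MinTensor.map f' g' y = 0 := by
  have alg : ∀ (s : A₁ ⊗[ℂ] B₁) (t : A₂ ⊗[ℂ] B₂),
      MinTensor.algMap f g s * MinTensor.algMap f' g' t = 0 := by
    intro s t
    induction s using TensorProduct.induction_on with
    | zero => rw [map_zero, zero_mul]
    | add s₁ s₂ h₁ h₂ => rw [map_add, add_mul, h₁, h₂, add_zero]
    | tmul a b =>
      induction t using TensorProduct.induction_on with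
      | zero => rw [map_zero, mul_zero]
      | add t₁ t₂ h₁ h₂ => rw [map_add, mul_add, h₁, h₂, add_zero]
      | tmul a' b' =>
        rw [MinTensor.algMap_tmul, MinTensor.algMap_tmul, Algebra.TensorProduct.tmul_mul_tmul]
        rcases h with h | h
        · rw [h, TensorProduct.zero_tmul]
        · rw [h, TensorProduct.tmul_zero]
  have c₁ : Continuous (MinTensor.map f g) := MinTensor.continuous_map f g
  have c₂ : Continuous (MinTensor.map f' g') := MinTensor.continuous_map f' g'
  refine MinTensor.denseRange_ofAlg.induction_on x
    (isClosed_eq (c₁.mul continuous_const) continuous_const) fun s => ?_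
  refine MinTensor.denseRange_ofAlg.induction_on y
    (isClosed_eq (continuous_const.mul c₂) continuous_const) fun t => ?_
  rw [MinTensor.map_ofAlg, MinTensor.map_ofAlg, ← map_mul, alg, map_zero]

/-- The embeddings `ζ` (`false`) and `η` (`true`). -/
def doublingEmb (Q : Type u) [CStarAlgebra Q] : Bool → (Q →⋆ₙₐ[ℂ] Q × Q)
  | false => zetaHom Q
  | true => etaHom Q

/-- The map `(ε_i ⊗ (ε_j φ^i)) Δ`, where `ε_false = ζ`, `ε_true = η`, and `φ^i` is `id` if `i` is
`false` and `φ` if `i` is `true`. -/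
def doublingComponent (Δ : Q →⋆ₐ[ℂ] MinTensor Q Q) (φ : Q →⋆ₐ[ℂ] Q) (i j : Bool) :
    Q →⋆ₙₐ[ℂ] MinTensor (Q × Q) (Q × Q) :=
  (MinTensor.map (doublingEmb Q i) (match i with
    | false => doublingEmb Q j
    | true => (doublingEmb Q j).comp (φ : Q →⋆ₙₐ[ℂ] Q))).comp (Δ : Q →⋆ₙₐ[ℂ] MinTensor Q Q)

theorem doublingEmb_mul {i j : Bool} (h : i ≠ j) (a b : Q) :
    doublingEmb Q i a * doublingEmb Q j b = 0 := by
  cases i <;> cases j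
  · exact absurd rfl h
  · change (a * 0, 0 * b) = 0; simp
  · change (0 * b, a * 0) = 0; simp
  · exact absurd rfl h

theorem doublingComponent_mul (Δ : Q →⋆ₐ[ℂ] MinTensor Q Q) (φ : Q →⋆ₐ[ℂ] Q) {i j k l : Bool}
    (h : (i, j) ≠ (k, l)) (a b : Q) :
    doublingComponent Δ φ i j a * doublingComponent Δ φ k l b = 0 := by
  refine MinTensor.map_mul_map_eq_zero _ _ _ _ ?_ (Δ a) (Δ b)
  by_cases hik : i = k
  · right
    have hjl : j ≠ l := fun hjl => h (by rw [hik, hjl])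
    intro a b
    subst hik
    cases i
    · exact doublingEmb_mul hjl _ _
    · exact doublingEmb_mul hjl _ _
  · left
    exact doublingEmb_mul hik

/-- The comultiplication `Δ_φ` of the doubling of `(Q, Δ)` by the involutive automorphism `φ`, with
underlying C*-algebra `Q ⊕ Q`; it is determined by
`Δ_φ ζ = (ζ ⊗ ζ + η ⊗ (η φ)) Δ` and `Δ_φ η = (ζ ⊗ η + η ⊗ (ζ φ)) Δ`. -/
def doublingComul (Δ : Q →⋆ₐ[ℂ] MinTensor Q Q) (φ : Q →⋆ₐ[ℂ] Q) :
    Q × Q →⋆ₐ[ℂ] MinTensor (Q × Q) (Q × Q) :=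
  let c := doublingComponent Δ φ
  have one : c false false 1 + c true true 1 + (c false true 1 + c true false 1) = 1 := by
    have e : Δ 1 = MinTensor.tmul 1 1 := (map_one Δ).trans MinTensor.one_def
    change MinTensor.map (zetaHom Q) (zetaHom Q) (Δ 1) +
      MinTensor.map (etaHom Q) ((etaHom Q).comp (φ : Q →⋆ₙₐ[ℂ] Q)) (Δ 1) +
      (MinTensor.map (zetaHom Q) (etaHom Q) (Δ 1) +
      MinTensor.map (etaHom Q) ((zetaHom Q).comp (φ : Q →⋆ₙₐ[ℂ] Q)) (Δ 1)) = 1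
    rw [e, MinTensor.map_tmul, MinTensor.map_tmul, MinTensor.map_tmul, MinTensor.map_tmul]
    have hφ : (φ : Q →⋆ₙₐ[ℂ] Q) 1 = 1 := map_one φ
    rw [NonUnitalStarAlgHom.comp_apply, NonUnitalStarAlgHom.comp_apply, hφ, MinTensor.one_def]
    have hs : zetaHom Q 1 + etaHom Q 1 = 1 := by
      change ((1 + 0, 0 + 1) : Q × Q) = 1
      simp [Prod.ext_iff]
    rw [← hs]
    simp only [MinTensor.tmul, ← map_add, TensorProduct.add_tmul, TensorProduct.tmul_add]
    congr 1
    abel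
  { toFun := fun x => c false false x.1 + c true true x.1 + (c false true x.2 + c true false x.2)
    map_one' := one
    map_mul' := fun x y => by
      have hz : ∀ {i j k l : Bool}, (i, j) ≠ (k, l) → ∀ a b, c i j a * c k l b = 0 :=
        fun h a b => doublingComponent_mul Δ φ h a b
      simp only [Prod.fst_mul, Prod.snd_mul, map_mul, mul_add, add_mul]
      rw [hz (i := true) (j := true) (k := false) (l := false) (by simp),
        hz (i := false) (j := true) (k := false) (l := false) (by simp),
        hz (i := true) (j := false) (k := false) (l := false) (by simp),
        hz (i := false) (j := false) (k := true) (l := true) (by simp),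
        hz (i := false) (j := true) (k := true) (l := true) (by simp),
        hz (i := true) (j := false) (k := true) (l := true) (by simp),
        hz (i := false) (j := false) (k := false) (l := true) (by simp),
        hz (i := true) (j := true) (k := false) (l := true) (by simp),
        hz (i := true) (j := false) (k := false) (l := true) (by simp),
        hz (i := false) (j := false) (k := true) (l := false) (by simp),
        hz (i := true) (j := true) (k := true) (l := false) (by simp),
        hz (i := false) (j := true) (k := true) (l := false) (by simp)]
      simp only [add_zero, zero_add]
    map_zero' := by simp only [Prod.fst_zero, Prod.snd_zero, map_zero, add_zero]
    map_add' := fun x y => by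
      simp only [Prod.fst_add, Prod.snd_add, map_add]
      abel
    commutes' := fun z => by
      rw [Algebra.algebraMap_eq_smul_one, Algebra.algebraMap_eq_smul_one]
      simp only [Prod.smul_fst, Prod.smul_snd, Prod.fst_one, Prod.snd_one, map_smul]
      rw [← smul_add, ← smul_add, ← smul_add, one]
    map_star' := fun x => by
      simp only [Prod.fst_star, Prod.snd_star, map_star, star_add] }

theorem doublingComul_zeta (Δ : Q →⋆ₐ[ℂ] MinTensor Q Q) (φ : Q →⋆ₐ[ℂ] Q) (a : Q) :
    doublingComul Δ φ (zetaHom Q a) =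
      MinTensor.map (zetaHom Q) (zetaHom Q) (Δ a) +
      MinTensor.map (etaHom Q) ((etaHom Q).comp (φ : Q →⋆ₙₐ[ℂ] Q)) (Δ a) := by
  change doublingComponent Δ φ false false a + doublingComponent Δ φ true true a +
    (doublingComponent Δ φ false true 0 + doublingComponent Δ φ true false 0) = _
  rw [map_zero, map_zero, add_zero, add_zero]; rfl

theorem doublingComul_eta (Δ : Q →⋆ₐ[ℂ] MinTensor Q Q) (φ : Q →⋆ₐ[ℂ] Q) (a : Q) :
    doublingComul Δ φ (etaHom Q a) =
      MinTensor.map (zetaHom Q) (etaHom Q) (Δ a) +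
      MinTensor.map (etaHom Q) ((zetaHom Q).comp (φ : Q →⋆ₙₐ[ℂ] Q)) (Δ a) := by
  change doublingComponent Δ φ false false 0 + doublingComponent Δ φ true true 0 +
    (doublingComponent Δ φ false true a + doublingComponent Δ φ true false a) = _
  rw [map_zero, map_zero, zero_add, zero_add]; rfl

end QuantumGroups

/-! ### The free product of copies of `C(S¹)` -/

/-- The relations saying that all generators are unitary. -/
def unitaryRelations (E : Type u) : CStarRelations E where
  holds _ _ f := ∀ e, star (f e) * f e = 1 ∧ f e * star (f e) = 1
  norm_le B _ f hf x := by
    have h : ‖f x‖ * ‖f x‖ ≤ 1 := by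
      rw [← CStarRing.norm_star_mul_self, (hf x).1]
      rcases subsingleton_or_nontrivial B with h | h
      · rw [Subsingleton.elim (1 : B) 0, norm_zero]; exact zero_le_one
      · exact CStarRing.norm_one.le
    nlinarith [norm_nonneg (f x)]

/-- The free product of copies of `C(S¹)`, one copy for every element of `E`: the universal
C*-algebra generated by unitaries indexed by `E`. -/
abbrev FreeCircles (E : Type u) : Type u := (unitaryRelations E).Univ

namespace FreeCircles

variable {E : Type u}

/-- The canonical unitary generators. -/
def z (e : E) : FreeCircles E := (unitaryRelations E).gen e

theorem z_unitary (e : E) : star (z e) * z e = 1 ∧ z e * star (z e) = 1 := by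
  have h1 := (unitaryRelations E).ofFree_eq_of_forall
    (star (FreeStar.gen e) * FreeStar.gen e) 1 (fun B _ f hf => by
      rw [map_mul, map_star, map_one, FreeStar.lift_gen, (hf e).1])
  have h2 := (unitaryRelations E).ofFree_eq_of_forall
    (FreeStar.gen e * star (FreeStar.gen e)) 1 (fun B _ f hf => by
      rw [map_mul, map_star, map_one, FreeStar.lift_gen, (hf e).2])
  rw [map_mul, map_star, map_one] at h1 h2
  exact ⟨h1, h2⟩

/-- The comultiplication `Δ_*` of the free product of copies of `C(S¹)`, with
`Δ_*(z e) = z e ⊗ z e`. -/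
def comul (E : Type u) : FreeCircles E →⋆ₐ[ℂ] MinTensor (FreeCircles E) (FreeCircles E) :=
  (unitaryRelations E).lift (fun e => MinTensor.tmul (z e) (z e)) fun e => by
    rw [MinTensor.star_tmul, MinTensor.tmul_mul_tmul, MinTensor.tmul_mul_tmul, (z_unitary e).1,
      (z_unitary e).2]
    exact ⟨MinTensor.one_def.symm, MinTensor.one_def.symm⟩

theorem comul_z (e : E) : comul E (z e) = MinTensor.tmul (z e) (z e) :=
  (unitaryRelations E).lift_gen _ _ e

end FreeCircles

/-! ### Quantum symmetry of graph C*-algebras -/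

namespace DirectedGraph

variable {V E : Type u} [Fintype V] [Fintype E] (Γ : DirectedGraph V E)

theorem isCKFamily_canonical : Γ.IsCKFamily Γ.p Γ.S := by
  classical
  have key := fun a b h => Γ.ckRelations.ofFree_eq_of_forall a b h
  constructor
  · intro v
    have h := key (star (FreeStar.gen (Sum.inl v))) (FreeStar.gen (Sum.inl v)) fun B _ f hf => by
      rw [map_star, FreeStar.lift_gen]; exact hf.star_p v
    rwa [map_star] at h
  · intro v w
    have h := key (FreeStar.gen (Sum.inl v) * FreeStar.gen (Sum.inl w))
      (if v = w then FreeStar.gen (Sum.inl v) else 0) fun B _ f hf => by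
        have h' := hf.p_mul_p v w
        split_ifs at h' ⊢ <;> simpa [FreeStar.lift_gen] using h'
    rw [map_mul] at h
    refine h.trans ?_
    split_ifs
    · rfl
    · exact map_zero _
  · have h := key (∑ v, FreeStar.gen (Sum.inl v)) 1 fun B _ f hf => by
      rw [map_sum, map_one]
      simp only [FreeStar.lift_gen]
      exact hf.sum_p
    rw [map_sum, map_one] at h
    exact h
  · intro e
    have h := key (FreeStar.gen (Sum.inr e) * star (FreeStar.gen (Sum.inr e)) *
      FreeStar.gen (Sum.inr e)) (FreeStar.gen (Sum.inr e)) fun B _ f hf => by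
        simp only [map_mul, map_star, FreeStar.lift_gen]
        exact hf.partialIsometry e
    simp only [map_mul, map_star] at h
    exact h
  · intro e
    have h := key (star (FreeStar.gen (Sum.inr e)) * FreeStar.gen (Sum.inr e))
      (FreeStar.gen (Sum.inl (Γ.r e))) fun B _ f hf => by
        simp only [map_mul, map_star, FreeStar.lift_gen]
        exact hf.star_S_mul_S e
    simp only [map_mul, map_star] at h
    exact h
  · intro v hv
    have h := key (FreeStar.gen (Sum.inl v)) (∑ f ∈ Finset.univ.filter (fun f => Γ.s f = v),
      FreeStar.gen (Sum.inr f) * star (FreeStar.gen (Sum.inr f))) fun B _ f hf => by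
        simp only [map_sum, map_mul, map_star, FreeStar.lift_gen]
        convert hf.sum_S_mul_star v hv
    simp only [map_sum, map_mul, map_star] at h
    refine Eq.trans h (Finset.sum_congr ?_ fun _ _ => rfl)
    congr

/-- The subspace `V_{2,+}` of the graph C*-algebra, spanned by the projections `p u` of the vertices
`u` that emit no edge and by the elements `S e S f*` with `r e = r f`. -/
def V2plus : Submodule ℂ Γ.CStar :=
  Submodule.span ℂ ({x | ∃ u, (∀ e, Γ.s e ≠ u) ∧ x = Γ.p u} ∪
    {x | ∃ e f, Γ.r e = Γ.r f ∧ x = Γ.S e * star (Γ.S f)})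

open Classical in
/-- `τ` is the linear functional on `V_{2,+}` with `τ (p u) = 1` and `τ (S e S f*) = δ_{ef}` for the
spanning elements of `V_{2,+}`. -/
def IsTau (τ : Γ.V2plus →ₗ[ℂ] ℂ) : Prop :=
  (∀ (x : Γ.V2plus) (u : V), (∀ e, Γ.s e ≠ u) → (x : Γ.CStar) = Γ.p u → τ x = 1) ∧
  (∀ (x : Γ.V2plus) (e f : E), Γ.r e = Γ.r f → (x : Γ.CStar) = Γ.S e * star (Γ.S f) →
    τ x = if e = f then 1 else 0)

variable {Q : Type u} [CStarAlgebra Q]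

/-- `α` is linear: `α (S e) = ∑ f, S f ⊗ q f e` for suitable elements `q f e` of `Q`. -/
def IsLinearAction (α : Γ.CStar →⋆ₐ[ℂ] MinTensor Γ.CStar Q) : Prop :=
  ∃ q : E → E → Q, ∀ e, α (Γ.S e) = ∑ f, MinTensor.tmul (Γ.S f) (q f e)

/-- `α` preserves `τ`: for `x` in `V_{2,+}` the element `α x` lies in the algebraic tensor product
`V_{2,+} ⊗ Q`, and `(τ ⊗ id) (α x) = τ x • 1`. -/
def PreservesTau (α : Γ.CStar →⋆ₐ[ℂ] MinTensor Γ.CStar Q) : Prop :=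
  ∃ τ : Γ.V2plus →ₗ[ℂ] ℂ, Γ.IsTau τ ∧ ∀ x : Γ.V2plus, ∃ y : Γ.V2plus ⊗[ℂ] Q,
    MinTensor.ofAlg (TensorProduct.map Γ.V2plus.subtype LinearMap.id y) = α x ∧
    TensorProduct.lid ℂ Q (TensorProduct.map τ LinearMap.id y) = τ x • (1 : Q)

/-- `((Q, Δ), α)` is an object of the category `𝔆_τ^Lin` of `Γ`: a compact quantum group with a
faithful linear `τ`-preserving action on the graph C*-algebra. -/
structure IsObject (Δ : Q →⋆ₐ[ℂ] MinTensor Q Q) (α : Γ.CStar →⋆ₐ[ℂ] MinTensor Γ.CStar Q) :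
    Prop where
  isCQG : IsCompactQuantumGroup Δ
  faithfulAction : IsFaithfulAction Δ α
  isLinear : Γ.IsLinearAction α
  preservesTau : Γ.PreservesTau α

/-- `((Q, Δ), α)` is a universal object of `𝔆_τ^Lin`: it is an object, and for every object
`((B, Δ'), β)` there is a surjective morphism `Φ` of compact quantum groups from `Q` to `B` with
`(id ⊗ Φ) α = β`. -/
def IsUniversalObject (Δ : Q →⋆ₐ[ℂ] MinTensor Q Q)
    (α : Γ.CStar →⋆ₐ[ℂ] MinTensor Γ.CStar Q) : Prop :=
  Γ.IsObject Δ α ∧ ∀ (B : Type u) [CStarAlgebra B] (Δ' : B →⋆ₐ[ℂ] MinTensor B B)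
    (β : Γ.CStar →⋆ₐ[ℂ] MinTensor Γ.CStar B), Γ.IsObject Δ' β →
    ∃ Φ : Q →⋆ₐ[ℂ] B, Function.Surjective Φ ∧ IsCQGMorphism Δ Δ' Φ ∧
      ∀ x, MinTensor.map (NonUnitalStarAlgHom.id ℂ Γ.CStar) (Φ : Q →⋆ₙₐ[ℂ] B) (α x) = β x

end DirectedGraph

end

/-! Two parallel edges can be exchanged, so `Γ` has an involutive edge symmetry `σ` preserving
sources and ranges. The free product of circles records only the independent rotations `S e ↦ S e ⊗
z e`. The doubling records these together with the exchange: it is the quantum analogue of the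
functions on a semidirect product `G ⋊ ℤ/2`, the two summands of `F ⊕ F` being the functions on the
two cosets.

Positive half. In each of the two orthogonal summands the proposed images of the `S e` form a
Cuntz-Krieger family, the second one permuted by `σ`, so universality of the graph algebra gives
`doubledAction`. Every axiom for an object (`IsEdgeSymmetry.isObject`) is then checked on
generators. This suffices because each axiom, suitably phrased, is stable under sums, products,
scalars and limits: associativity is membership in the closure of a subalgebra (`AssocRel.mul`,
`isClosed_assocRel`), and density reduces to membership of the `a ⊗ 1` or `1 ⊗ b` in a closed span
(`mul_mem_closedProductSpan`). Faithfulness and preservation of `τ` use functionals reading off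
coefficients of the `S e`. These exist because every `p v` is non-zero, which needs a concrete
representation (`exists_isCKFamily`).

Negative half. If the universal quantum group were `F`, the universal morphism onto the doubling
would be a surjection from `F`. But `F` is cocommutative, being generated by group-like unitaries,
and cocommutativity passes to quotients. In the doubling it fails: two characters supported on the
second summand have convolutions in the two orders that differ by a sign at `(z e₀, 0)`
(`not_surjective_of_isCQGMorphism`). Condition (R3) is the contrapositive. -/

noncomputable section

/-! ### Universal C*-algebras: induction and extensionality -/

namespace CStarRelations

variable {X : Type u} (R : CStarRelations X)

/-- Induction principle for the universal C*-algebra. -/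
theorem univ_induction {P : R.Univ → Prop} (hclosed : IsClosed {x | P x})
    (hone : P 1) (hgen : ∀ x, P (R.gen x)) (hstar : ∀ x, P (star (R.gen x)))
    (hsmul : ∀ (c : ℂ) a, P a → P (c • a)) (hmul : ∀ a b, P a → P b → P (a * b))
    (hadd : ∀ a b, P a → P b → P (a + b)) (a : R.Univ) : P a := by
  refine R.denseRange_mk.induction_on a hclosed fun t => ?_
  refine FreeStar.induction (P := fun t => P (R.ofFree t)) ?_ ?_ ?_ ?_ t
  · intro c
    rw [Algebra.algebraMap_eq_smul_one, map_smul, map_one]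
    exact hsmul c 1 hone
  · rintro (x | x)
    · exact hgen x
    · have h := hstar x
      rw [gen, ← map_star] at h
      have e : star (FreeStar.gen x) = FreeStar.sym (Sum.inr x) := FreeStar.star_sym _
      rwa [e] at h
  · intro a b ha hb
    rw [map_mul]
    exact hmul _ _ ha hb
  · intro a b ha hb
    rw [map_add]
    exact hadd _ _ ha hb

/-- Two `*`-homomorphisms on the universal C*-algebra that agree on the unit and on the generators
are equal. -/
theorem univ_hom_ext {B : Type u} [CStarAlgebra B] (f g : R.Univ →⋆ₙₐ[ℂ] B) (hone : f 1 = g 1)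
    (hgen : ∀ x, f (R.gen x) = g (R.gen x)) (a : R.Univ) : f a = g a := by
  have cf : Continuous f := AddMonoidHomClass.continuous_of_bound f 1 fun x => by
    rw [one_mul]; exact NonUnitalStarAlgHom.norm_apply_le f x
  have cg : Continuous g := AddMonoidHomClass.continuous_of_bound g 1 fun x => by
    rw [one_mul]; exact NonUnitalStarAlgHom.norm_apply_le g x
  refine R.univ_induction (P := fun a => f a = g a) (isClosed_eq cf cg) hone hgen ?_ ?_ ?_ ?_ a
  · intro x; rw [map_star, map_star, hgen]
  · intro c a h; rw [map_smul, map_smul, h]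
  · intro a b ha hb; rw [map_mul, map_mul, ha, hb]
  · intro a b ha hb; rw [map_add, map_add, ha, hb]

end CStarRelations

theorem StarAlgHom.continuous_of_cstar {A B : Type u} [CStarAlgebra A] [CStarAlgebra B]
    (f : A →⋆ₐ[ℂ] B) : Continuous f :=
  AddMonoidHomClass.continuous_of_bound f 1 fun x => by
    rw [one_mul]; exact NonUnitalStarAlgHom.norm_apply_le f x

/-! ### Elementary tensors and the associativity relation -/

namespace MinTensor

variable {A B C D : Type u} [CStarAlgebra A] [CStarAlgebra B] [CStarAlgebra C] [CStarAlgebra D]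

theorem tmul_add (a : A) (b b' : B) : tmul a (b + b') = tmul a b + tmul a b' := by
  simp only [tmul, TensorProduct.tmul_add, map_add]

theorem add_tmul (a a' : A) (b : B) : tmul (a + a') b = tmul a b + tmul a' b := by
  simp only [tmul, TensorProduct.add_tmul, map_add]

theorem tmul_smul (c : ℂ) (a : A) (b : B) : tmul a (c • b) = c • tmul a b := by
  simp only [tmul, TensorProduct.tmul_smul, map_smul]

theorem smul_tmul (c : ℂ) (a : A) (b : B) : tmul (c • a) b = c • tmul a b := by
  rw [tmul, tmul, ← map_smul, TensorProduct.smul_tmul']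

@[simp] theorem tmul_zero (a : A) : tmul a (0 : B) = 0 := by
  simp only [tmul, TensorProduct.tmul_zero, map_zero]

@[simp] theorem zero_tmul (b : B) : tmul (0 : A) b = 0 := by
  simp only [tmul, TensorProduct.zero_tmul, map_zero]

theorem sum_tmul {ι : Type*} (s : Finset ι) (f : ι → A) (b : B) :
    tmul (∑ i ∈ s, f i) b = ∑ i ∈ s, tmul (f i) b := by
  simp only [tmul, TensorProduct.sum_tmul, map_sum]

/-- Gives continuity in each leg separately, which makes conditions such as `a ⊗ 1 ∈ T`, with `T`
closed, closed conditions on `a`. -/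
theorem norm_tmul_le (a : A) (b : B) : ‖tmul a b‖ ≤ ‖a‖ * ‖b‖ := by
  refine ((minNorm A B).norm_coe _).le.trans
    (CStarSeminorm.sup_le _ _ _ (by positivity) ?_)
  rintro _ ⟨H, K, _, _, _, _, _, _, π, σ, rfl⟩
  rw [repSeminorm_apply, rep_tmul]
  exact (TensorProduct.norm_mapL_le (π a) (σ b)).trans
    (mul_le_mul (NonUnitalStarAlgHom.norm_apply_le π a)
      (NonUnitalStarAlgHom.norm_apply_le σ b) (norm_nonneg _) (norm_nonneg _))

theorem continuous_tmul_left (b : B) : Continuous fun a : A => tmul a b :=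
  AddMonoidHomClass.continuous_of_bound
    (AddMonoidHom.mk' (fun a : A => tmul a b) fun a a' => add_tmul a a' b) ‖b‖ fun a =>
      (norm_tmul_le a b).trans (mul_comm _ _).le

theorem continuous_tmul_right (a : A) : Continuous fun b : B => tmul a b :=
  AddMonoidHomClass.continuous_of_bound
    (AddMonoidHom.mk' (fun b : B => tmul a b) fun b b' => tmul_add a b b') ‖a‖ fun b =>
      norm_tmul_le a b

/-- The algebraic associativity correspondence. -/
def assocPair : (A ⊗[ℂ] B) ⊗[ℂ] C →ₐ[ℂ]
    MinTensor (MinTensor A B) C × MinTensor A (MinTensor B C) :=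
  AlgHom.prod
    ((ofAlg : MinTensor A B ⊗[ℂ] C →⋆ₐ[ℂ] _).toAlgHom.comp
      (Algebra.TensorProduct.map (ofAlg : A ⊗[ℂ] B →⋆ₐ[ℂ] MinTensor A B).toAlgHom
        (AlgHom.id ℂ C)))
    (((ofAlg : A ⊗[ℂ] MinTensor B C →⋆ₐ[ℂ] _).toAlgHom.comp
      (Algebra.TensorProduct.map (AlgHom.id ℂ A)
        (ofAlg : B ⊗[ℂ] C →⋆ₐ[ℂ] MinTensor B C).toAlgHom)).comp
      (Algebra.TensorProduct.assoc ℂ ℂ ℂ A B C).toAlgHom)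

theorem assocPair_tmul (a : A) (b : B) (c : C) :
    assocPair ((a ⊗ₜ b) ⊗ₜ c) = (tmul (tmul a b) c, tmul a (tmul b c)) := rfl

/-- The graph in the definition of `AssocRel` is the range of an algebra homomorphism. The relation
is thus the closure of a subalgebra, and compatibility with the operations follows from their
continuity, without constructing the associativity isomorphism. -/
theorem assocRel_iff (x : MinTensor (MinTensor A B) C) (y : MinTensor A (MinTensor B C)) :
    AssocRel x y ↔ (x, y) ∈ closure (Set.range (assocPair (A := A) (B := B) (C := C))) :=
  Iff.rfl

theorem AssocRel.tmul (a : A) (b : B) (c : C) :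
    AssocRel (MinTensor.tmul (MinTensor.tmul a b) c) (MinTensor.tmul a (MinTensor.tmul b c)) :=
  subset_closure ⟨(a ⊗ₜ b) ⊗ₜ c, rfl⟩

variable {x x' : MinTensor (MinTensor A B) C} {y y' : MinTensor A (MinTensor B C)}

theorem AssocRel.add (h : AssocRel x y) (h' : AssocRel x' y') :
    AssocRel (x + x') (y + y') := by
  rw [assocRel_iff] at h h' ⊢
  refine map_mem_closure₂ (f := fun p q => p + q) continuous_add h h' ?_
  rintro _ ⟨s, rfl⟩ _ ⟨t, rfl⟩
  exact ⟨s + t, map_add _ _ _⟩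

theorem AssocRel.mul (h : AssocRel x y) (h' : AssocRel x' y') :
    AssocRel (x * x') (y * y') := by
  rw [assocRel_iff] at h h' ⊢
  have key : ∀ p ∈ Set.range (assocPair (A := A) (B := B) (C := C)),
      ∀ q ∈ Set.range (assocPair (A := A) (B := B) (C := C)),
      p * q ∈ Set.range (assocPair (A := A) (B := B) (C := C)) := by
    rintro _ ⟨s, rfl⟩ _ ⟨t, rfl⟩
    exact ⟨s * t, map_mul _ _ _⟩
  have e : (x * x', y * y') = (x, y) * (x', y') := rfl
  rw [e]
  exact map_mem_closure₂ continuous_mul h h' key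

theorem AssocRel.smul (c : ℂ) (h : AssocRel x y) : AssocRel (c • x) (c • y) := by
  rw [assocRel_iff] at h ⊢
  refine map_mem_closure (f := fun p => c • p) (continuous_const_smul c) h ?_
  rintro _ ⟨s, rfl⟩
  exact ⟨c • s, map_smul _ _ _⟩

/-- `assocPair` is built only as an algebra homomorphism, so stability of its range under the
involution is verified on elementary tensors. -/
theorem AssocRel.star (h : AssocRel x y) : AssocRel (star x) (star y) := by
  rw [assocRel_iff] at h ⊢
  refine map_mem_closure (f := fun p => Star.star p) continuous_star h ?_
  rintro _ ⟨s, rfl⟩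
  change Star.star (assocPair s) ∈ _
  induction s using TensorProduct.induction_on with
  | zero => exact ⟨0, by simp⟩
  | add s t hs ht =>
    obtain ⟨s', hs⟩ := hs
    obtain ⟨t', ht⟩ := ht
    exact ⟨s' + t', by rw [map_add, map_add, star_add, hs, ht]⟩
  | tmul s c =>
    induction s using TensorProduct.induction_on with
    | zero => exact ⟨0, by simp⟩
    | add s t hs ht =>
      obtain ⟨s', hs⟩ := hs
      obtain ⟨t', ht⟩ := ht
      exact ⟨s' + t', by rw [TensorProduct.add_tmul, map_add, map_add, star_add, hs, ht]⟩
    | tmul a b =>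
      refine ⟨(Star.star a ⊗ₜ Star.star b) ⊗ₜ Star.star c, ?_⟩
      rw [assocPair_tmul, assocPair_tmul, Prod.star_def, star_tmul, star_tmul, star_tmul, star_tmul]

theorem isClosed_assocRel {Y : Type*} [TopologicalSpace Y]
    {f : Y → MinTensor (MinTensor A B) C} {g : Y → MinTensor A (MinTensor B C)}
    (hf : Continuous f) (hg : Continuous g) : IsClosed {y | AssocRel (f y) (g y)} :=
  isClosed_closure.preimage (hf.prodMk hg)

end MinTensor

/-! ### Density of spans of products -/

section Density

variable {A Q M : Type u} [CStarAlgebra M]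

/-- The closed linear span of the products `f a * g b`. -/
def closedProductSpan (f : A → M) (g : Q → M) : Submodule ℂ M :=
  (Submodule.span ℂ {x : M | ∃ a b, x = f a * g b}).topologicalClosure

theorem mem_closedProductSpan (f : A → M) (g : Q → M) (a : A) (b : Q) :
    f a * g b ∈ closedProductSpan f g :=
  Submodule.le_topologicalClosure _ (Submodule.subset_span ⟨a, b, rfl⟩)

theorem isClosed_closedProductSpan (f : A → M) (g : Q → M) :
    IsClosed (closedProductSpan f g : Set M) :=
  Submodule.isClosed_topologicalClosure _

theorem closedProductSpan_induction {f : A → M} {g : Q → M} {P : M → Prop}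
    (hclosed : IsClosed {x | P x}) (hmul : ∀ a b, P (f a * g b)) (hzero : P 0)
    (hadd : ∀ x y, P x → P y → P (x + y)) (hsmul : ∀ (c : ℂ) x, P x → P (c • x))
    {x : M} (hx : x ∈ closedProductSpan f g) : P x := by
  refine closure_minimal (s := (Submodule.span ℂ {x : M | ∃ a b, x = f a * g b} : Set M))
    (t := {x | P x}) (fun y hy => ?_) hclosed hx
  exact Submodule.span_induction (p := fun y _ => P y) (by rintro _ ⟨a, b, rfl⟩; exact hmul a b)
    hzero (fun x y _ _ => hadd x y) (fun c x _ => hsmul c x) hy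

theorem mul_map_mem_closedProductSpan [Mul Q] (f : A → M) {g : Q → M}
    (hg : ∀ b b', g b * g b' = g (b * b'))
    (b : Q) {x : M} (hx : x ∈ closedProductSpan f g) : x * g b ∈ closedProductSpan f g := by
  refine closedProductSpan_induction (P := fun x => x * g b ∈ closedProductSpan f g)
    ((isClosed_closedProductSpan _ _).preimage (continuous_id.mul continuous_const))
    (fun a b' => ?_) ?_ (fun x y hx hy => ?_) (fun c x hx => ?_) hx
  · rw [mul_assoc, hg]; exact mem_closedProductSpan _ _ _ _
  · rw [zero_mul]; exact zero_mem _
  · rw [add_mul]; exact add_mem hx hy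
  · rw [smul_mul_assoc]; exact Submodule.smul_mem _ _ hx

variable [CStarAlgebra A]

theorem map_mul_mem_closedProductSpan (f : A →⋆ₐ[ℂ] M) (g : Q → M) (a : A) {x : M}
    (hx : x ∈ closedProductSpan f g) : f a * x ∈ closedProductSpan f g := by
  refine closedProductSpan_induction (P := fun x => f a * x ∈ closedProductSpan f g)
    ((isClosed_closedProductSpan _ _).preimage (continuous_const.mul continuous_id))
    (fun a' b => ?_) ?_ (fun x y hx hy => ?_) (fun c x hx => ?_) hx
  · rw [← mul_assoc, ← map_mul]; exact mem_closedProductSpan _ _ _ _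
  · rw [mul_zero]; exact zero_mem _
  · rw [mul_add]; exact add_mem hx hy
  · rw [mul_smul_comm]; exact Submodule.smul_mem _ _ hx

/-- The elements of the closed span of `f(A) g(Q)` that commute with `g(Q)` form a multiplicative
set. -/
theorem mul_mem_closedProductSpan [Mul Q] (f : A →⋆ₐ[ℂ] M) {g : Q → M}
    (hg : ∀ b b', g b * g b' = g (b * b')) {x y : M} (hx : x ∈ closedProductSpan f g)
    (hy : y ∈ closedProductSpan f g) (hcomm : ∀ b, y * g b = g b * y) :
    x * y ∈ closedProductSpan f g := by
  refine closedProductSpan_induction (P := fun x => x * y ∈ closedProductSpan f g)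
    ((isClosed_closedProductSpan _ _).preimage (continuous_id.mul continuous_const))
    (fun a b => ?_) ?_ (fun x y hx hy => ?_) (fun c x hx => ?_) hx
  -- Moving `y` to the left past `g b` leaves `f a * (y * g b)`; the closed span is a left module
  -- over `f(A)` and a right module over `g(Q)`.
  · rw [mul_assoc, ← hcomm]
    exact map_mul_mem_closedProductSpan f g a (mul_map_mem_closedProductSpan f hg b hy)
  · rw [zero_mul]; exact zero_mem _
  · rw [add_mul]; exact add_mem hx hy
  · rw [smul_mul_assoc]; exact Submodule.smul_mem _ _ hx

variable [CStarAlgebra Q]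

theorem MinTensor.dense_of_tmul_mem {T : Submodule ℂ (MinTensor A Q)}
    (h : ∀ a b, MinTensor.tmul a b ∈ T.topologicalClosure) :
    Dense (T : Set (MinTensor A Q)) := by
  intro x
  rw [← Submodule.topologicalClosure_coe]
  refine MinTensor.denseRange_ofAlg.induction_on x
    (Submodule.isClosed_topologicalClosure T) fun t => ?_
  induction t using TensorProduct.induction_on with
  | zero => rw [map_zero]; exact zero_mem _
  | add s t hs ht => rw [map_add]; exact add_mem hs ht
  | tmul a b => exact h a b

/-- The closed span is a right module over `1 ⊗ Q`, so from `a ⊗ 1` it contains every `a ⊗ b`. -/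
theorem MinTensor.dense_span_mul_one_tmul {B : Type u} [CStarAlgebra B]
    (f : B →⋆ₐ[ℂ] MinTensor A Q)
    (h : ∀ a, MinTensor.tmul a 1 ∈ closedProductSpan f fun b => MinTensor.tmul (1 : A) b) :
    Dense (Submodule.span ℂ {x : MinTensor A Q | ∃ (a : B) (b : Q),
      x = f a * MinTensor.tmul 1 b} : Set (MinTensor A Q)) := by
  refine MinTensor.dense_of_tmul_mem fun a b => ?_
  have := mul_map_mem_closedProductSpan f (g := fun b => MinTensor.tmul (1 : A) b)
    (fun b b' => by rw [MinTensor.tmul_mul_tmul, one_mul]) b (h a)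
  rwa [MinTensor.tmul_mul_tmul, one_mul, mul_one] at this

theorem MinTensor.dense_span_mul_tmul_one {B : Type u} [CStarAlgebra B]
    (f : B →⋆ₐ[ℂ] MinTensor A Q)
    (h : ∀ b, MinTensor.tmul 1 b ∈ closedProductSpan f fun a => MinTensor.tmul a (1 : Q)) :
    Dense (Submodule.span ℂ {x : MinTensor A Q | ∃ (b : B) (a : A),
      x = f b * MinTensor.tmul a 1} : Set (MinTensor A Q)) := by
  refine MinTensor.dense_of_tmul_mem fun a b => ?_
  have := mul_map_mem_closedProductSpan f (g := fun a => MinTensor.tmul a (1 : Q))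
    (fun b b' => by rw [MinTensor.tmul_mul_tmul, one_mul]) a (h b)
  rwa [MinTensor.tmul_mul_tmul, one_mul, mul_one] at this

/-- `a' ⊗ 1` commutes with `1 ⊗ Q`, so the set of all `a` with `a ⊗ 1` in the closed span is closed
under products. This is what reduces the density axioms to generators. -/
theorem MinTensor.tmul_one_mul_mem {B : Type u} [CStarAlgebra B]
    (f : B →⋆ₐ[ℂ] MinTensor A Q) {a a' : A}
    (h : MinTensor.tmul a 1 ∈ closedProductSpan f fun b : Q => MinTensor.tmul (1 : A) b)
    (h' : MinTensor.tmul a' 1 ∈ closedProductSpan f fun b : Q => MinTensor.tmul (1 : A) b) :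
    MinTensor.tmul (a * a') 1 ∈ closedProductSpan f fun b : Q => MinTensor.tmul (1 : A) b := by
  have := mul_mem_closedProductSpan f (fun b b' => by
    rw [MinTensor.tmul_mul_tmul, one_mul]) h h' fun b => by
      simp only [MinTensor.tmul_mul_tmul, one_mul, mul_one]
  rwa [MinTensor.tmul_mul_tmul, one_mul] at this

theorem MinTensor.one_tmul_mul_mem {B : Type u} [CStarAlgebra B]
    (f : B →⋆ₐ[ℂ] MinTensor A Q) {b b' : Q}
    (h : MinTensor.tmul 1 b ∈ closedProductSpan f fun a : A => MinTensor.tmul a (1 : Q))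
    (h' : MinTensor.tmul 1 b' ∈ closedProductSpan f fun a : A => MinTensor.tmul a (1 : Q)) :
    MinTensor.tmul 1 (b * b') ∈ closedProductSpan f fun a : A => MinTensor.tmul a (1 : Q) := by
  have := mul_mem_closedProductSpan f (fun b b' => by
    rw [MinTensor.tmul_mul_tmul, one_mul]) h h' fun b => by
      simp only [MinTensor.tmul_mul_tmul, one_mul, mul_one]
  rwa [MinTensor.tmul_mul_tmul, one_mul] at this

end Density

/-! ### Sums of projections -/

section Projections

variable {A : Type u} [CStarAlgebra A]

/-- The summands are positive for the spectral order, so each vanishes, and the C*-identity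
finishes. -/
theorem CStarAlgebra.eq_zero_of_sum_star_mul_self_eq_zero {ι : Type*} (s : Finset ι) (a : ι → A)
    (h : ∑ i ∈ s, star (a i) * a i = 0) {i : ι} (hi : i ∈ s) : a i = 0 := by
  let := CStarAlgebra.spectralOrder A
  have := CStarAlgebra.spectralOrderedRing A
  have h' := (Finset.sum_eq_zero_iff_of_nonneg fun i _ => star_mul_self_nonneg (a i)).1 h i hi
  exact CStarRing.star_mul_self_eq_zero_iff _ |>.1 h'

/-- Projections whose sum is a projection are dominated by the sum. -/
theorem CStarAlgebra.mul_sum_of_projections {ι : Type*} (s : Finset ι) (P : ι → A)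
    (hstar : ∀ i, star (P i) = P i) (hmul : ∀ i, P i * P i = P i)
    (hsum : (∑ i ∈ s, P i) * (∑ i ∈ s, P i) = ∑ i ∈ s, P i) {i : ι} (hi : i ∈ s) :
    P i * ∑ j ∈ s, P j = P i := by
  set p := ∑ j ∈ s, P j with hp
  have hps : star p = p := by rw [hp, star_sum]; simp only [hstar]
  -- The sum of the `(1 - p) P j (1 - p)` is `(1 - p) p (1 - p) = 0`.
  have h := CStarAlgebra.eq_zero_of_sum_star_mul_self_eq_zero s (fun j => P j * (1 - p)) (by
    have : ∀ j, star (P j * (1 - p)) * (P j * (1 - p)) = (1 - p) * P j * (1 - p) := fun j => by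
      rw [star_mul, star_sub, star_one, hps, hstar, mul_assoc, ← mul_assoc (P j), hmul,
        mul_assoc]
    simp only [this]
    rw [← Finset.sum_mul, ← Finset.mul_sum, ← hp, sub_mul, one_mul, hsum, sub_self, zero_mul]) hi
  simp only [mul_sub, mul_one, sub_eq_zero] at h
  exact h.symm

/-- Projections whose sum is a projection are mutually orthogonal. -/
theorem CStarAlgebra.mul_eq_zero_of_projections {ι : Type*} (s : Finset ι) (P : ι → A)
    (hstar : ∀ i, star (P i) = P i) (hmul : ∀ i, P i * P i = P i)
    (hsum : (∑ i ∈ s, P i) * (∑ i ∈ s, P i) = ∑ i ∈ s, P i) {i j : ι} (hi : i ∈ s) (hj : j ∈ s)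
    (hij : i ≠ j) : P j * P i = 0 := by
  classical
  have h1 := CStarAlgebra.mul_sum_of_projections s P hstar hmul hsum hi
  -- With `p` the full sum, the sum of the `P i P k P i` over `k ≠ i` is `P i (p - P i) P i`, which
  -- is zero because `P i p = P i`.
  refine CStarAlgebra.eq_zero_of_sum_star_mul_self_eq_zero (s.erase i) (fun k => P k * P i) ?_
    (Finset.mem_erase.2 ⟨hij.symm, hj⟩)
  have : ∀ k, star (P k * P i) * (P k * P i) = P i * P k * P i := fun k => by
    rw [star_mul, hstar, hstar, mul_assoc, ← mul_assoc (P k), hmul, mul_assoc]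
  simp only [this]
  rw [← Finset.sum_mul, ← Finset.mul_sum, ← add_sub_cancel_left (P i) (∑ k ∈ s.erase i, P k),
    Finset.add_sum_erase s P hi, mul_sub, h1, hmul, sub_self, zero_mul]

end Projections

/-! ### Cuntz-Krieger families -/

namespace DirectedGraph

variable {V E : Type u} [Fintype V] [Fintype E] {Γ : DirectedGraph V E}

namespace IsCKFamily

variable {B : Type u} [CStarAlgebra B] {p : V → B} {S : E → B} (h : Γ.IsCKFamily p S)
include h

/-- Not one of the defining relations: it holds because the range projection of `S e` is a summand
of the projection `p (s e)` and hence lies below it. -/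
theorem p_mul_S (e : E) : p (Γ.s e) * S e = S e := by
  classical
  have hs := h.sum_S_mul_star (Γ.s e) ⟨e, rfl⟩
  have hm : S e * star (S e) * p (Γ.s e) = S e * star (S e) := by
    rw [hs]
    refine CStarAlgebra.mul_sum_of_projections _ (fun f => S f * star (S f)) (fun f => by simp)
      (fun f => by rw [← mul_assoc, h.partialIsometry]) ?_ (by simp)
    rw [← hs, h.p_mul_p, if_pos rfl]
  have hm' := congrArg star hm
  simp only [star_mul, star_star, h.star_p] at hm'
  rw [← h.partialIsometry e, ← mul_assoc, hm']

/-- With a common source, the two range projections are summands of one projection and hence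
orthogonal. With different sources, the ranges lie under orthogonal vertex projections. -/
theorem star_S_mul_S_of_ne {e f : E} (hef : e ≠ f) : star (S e) * S f = 0 := by
  classical
  by_cases hs : Γ.s e = Γ.s f
  · have hs' := h.sum_S_mul_star (Γ.s f) ⟨f, rfl⟩
    have hz : S e * star (S e) * (S f * star (S f)) = 0 := by
      refine CStarAlgebra.mul_eq_zero_of_projections
        (Finset.univ.filter fun g => Γ.s g = Γ.s f) (fun f => S f * star (S f))
        (fun f => by simp) (fun f => by rw [← mul_assoc, h.partialIsometry]) ?_ (i := f) (j := e)
        (by simp) (by simp [hs]) hef.symm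
      rw [← hs', h.p_mul_p, if_pos rfl]
    calc star (S e) * S f
        = star (S e) * (S e * star (S e) * (S f * star (S f))) * S f := by
          have h1 : star (S e) * (S e * star (S e)) = star (S e) := by
            have := congrArg star (h.partialIsometry e)
            rw [star_mul, star_mul, star_star] at this
            rw [this]
          rw [← mul_assoc (star (S e)), h1, mul_assoc, h.partialIsometry]
      _ = 0 := by rw [hz, mul_zero, zero_mul]
  · rw [← h.p_mul_S e, ← h.p_mul_S f, star_mul, h.star_p, mul_assoc, ← mul_assoc (p (Γ.s e)),
      h.p_mul_p, if_neg hs, zero_mul, mul_zero]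

open Classical in
theorem star_S_mul_S' (e f : E) : star (S e) * S f = if e = f then p (Γ.r e) else 0 := by
  split_ifs with hef
  · rw [← hef, h.star_S_mul_S]
  · exact h.star_S_mul_S_of_ne hef

theorem p_mul_S_of_ne {u : V} {e : E} (hu : Γ.s e ≠ u) : p u * S e = 0 := by
  classical
  rw [← h.p_mul_S e, ← mul_assoc, h.p_mul_p, if_neg hu.symm, zero_mul]

end IsCKFamily

end DirectedGraph

/-! ### Isometries with orthogonal ranges that add up to the whole space -/

section Cuntz

open scoped InnerProductSpace

variable {H : Type u} [NormedAddCommGroup H] [InnerProductSpace ℂ H]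

theorem HilbertBasis.clm_ext {N : Type*} (b : HilbertBasis N ℂ H) {f g : H →L[ℂ] H}
    (h : ∀ n, f (b n) = g (b n)) : f = g := by
  refine ContinuousLinearMap.ext_on (s := Set.range b) ?_ ?_
  · rw [Submodule.dense_iff_topologicalClosure_eq_top]
    exact b.dense_span
  · rintro _ ⟨n, rfl⟩
    exact h n

variable [CompleteSpace H]

/-- The bounded operator that maps an orthonormal basis to an orthonormal family. -/
def HilbertBasis.toIsometry {N : Type*} (b : HilbertBasis N ℂ H) {v : N → H}
    (hv : Orthonormal ℂ v) : H →L[ℂ] H :=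
  (hv.orthogonalFamily.linearIsometry.comp b.repr.toLinearIsometry).toContinuousLinearMap

theorem HilbertBasis.toIsometry_apply {N : Type*} (b : HilbertBasis N ℂ H) {v : N → H}
    (hv : Orthonormal ℂ v) (n : N) : b.toIsometry hv (b n) = v n := by
  classical
  change hv.orthogonalFamily.linearIsometry (b.repr (b n)) = v n
  rw [b.repr_self, OrthogonalFamily.linearIsometry_apply_single]
  simp

-- The bijection `β` cuts the basis into disjoint copies of itself indexed by `ι`, and `T i` carries
-- the basis onto the `i`-th copy.
open Classical in
theorem exists_cuntz_isometries {N ι : Type*} (b : HilbertBasis N ℂ H) [Fintype ι]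
    (β : ι × N ≃ N) : ∃ T : ι → (H →L[ℂ] H),
      (∀ i j, star (T i) * T j = if i = j then 1 else 0) ∧ ∑ i, T i * star (T i) = 1 := by
  have hv : ∀ i, Orthonormal ℂ fun n => b (β (i, n)) := fun i =>
    b.orthonormal.comp _ fun m n hmn => by simpa using hmn
  let T : ι → (H →L[ℂ] H) := fun i => b.toIsometry (hv i)
  have hT : ∀ i n, T i (b n) = b (β (i, n)) := fun i n => b.toIsometry_apply (hv i) n
  -- The adjoint of `T i` undoes it on the `i`-th block and kills the others, as comparison of
  -- coordinates shows. Both Cuntz relations follow on basis vectors.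
  have hT' : ∀ i j n, star (T i) (b (β (j, n))) = if i = j then b n else 0 := fun i j n => by
    apply b.repr.injective
    ext m
    rw [b.repr_apply_apply, b.repr_apply_apply, ContinuousLinearMap.star_eq_adjoint,
      ContinuousLinearMap.adjoint_inner_right, hT]
    have ho := orthonormal_iff_ite.1 b.orthonormal
    rw [ho]
    split_ifs with h1 h2 h2
    · have := β.injective h1
      rw [ho]; simp_all
    · have := β.injective h1
      simp_all
    · rw [ho, if_neg]
      rintro rfl
      exact h1 (by rw [h2])
    · simp
  refine ⟨T, fun i j => b.clm_ext fun n => ?_, b.clm_ext fun n => ?_⟩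
  · change star (T i) (T j (b n)) = _
    rw [hT, hT']
    split_ifs <;> rfl
  · obtain ⟨⟨j, m⟩, rfl⟩ := β.surjective n
    rw [sum_apply]
    change ∑ i, T i (star (T i) (b (β (j, m)))) = b (β (j, m))
    simp only [hT']
    rw [Finset.sum_eq_single j]
    · rw [if_pos rfl, hT]
    · intro i _ hi
      rw [if_neg hi, map_zero]
    · simp

end Cuntz

/-- A separable infinite-dimensional Hilbert space. -/
abbrev SeqHilbert : Type u := lp (fun _ : ULift.{u} ℕ => ℂ) 2

/-- The standard orthonormal basis. -/
def SeqHilbert.basis : HilbertBasis (ULift.{u} ℕ) ℂ SeqHilbert.{u} :=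
  HilbertBasis.ofRepr (LinearIsometryEquiv.refl ℂ _)

instance : Nontrivial SeqHilbert.{u} :=
  ⟨⟨SeqHilbert.basis ⟨0⟩, 0, SeqHilbert.basis.orthonormal.ne_zero _⟩⟩

/-- The bounded operators on a separable infinite-dimensional Hilbert space. -/
abbrev SeqOperators : Type u := SeqHilbert.{u} →L[ℂ] SeqHilbert.{u}

open Classical in
theorem SeqOperators.exists_isometries (ι : Type u) [Fintype ι] [Nonempty ι] :
    ∃ T : ι → SeqOperators.{u},
      (∀ i j, star (T i) * T j = if i = j then 1 else 0) ∧ ∑ i, T i * star (T i) = 1 := by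
  have : Encodable ι := Fintype.toEncodable ι
  have : Infinite (ι × ULift.{u} ℕ) := inferInstance
  have : Denumerable (ι × ULift.{u} ℕ) := Denumerable.ofEncodableOfInfinite _
  exact exists_cuntz_isometries SeqHilbert.basis
    ((Denumerable.eqv (ι × ULift.{u} ℕ)).trans Equiv.ulift.symm)

/-! ### Non-degeneracy of the graph C*-algebra, coefficient functionals and `τ` -/

namespace DirectedGraph

variable {V E : Type u} [Fintype V] [Fintype E] (Γ : DirectedGraph V E)

/-- Every finite graph has a Cuntz-Krieger family with non-zero vertex projections. -/
theorem exists_isCKFamily [Nonempty V] : ∃ (p : V → SeqOperators.{u}) (S : E → SeqOperators.{u}),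
    Γ.IsCKFamily p S ∧ ∀ v, p v ≠ 0 := by
  classical
  obtain ⟨U, hU, hU1⟩ := SeqOperators.exists_isometries V
  -- `U v` identifies the whole space with the range of the future `p v`; the `R v e` then split the
  -- whole space among the edges leaving `v`.
  have hR : ∀ v, ∃ R : E → SeqOperators.{u}, (∀ e, Γ.s e = v → star (R e) * R e = 1) ∧
      ((∃ e, Γ.s e = v) → ∑ f ∈ Finset.univ.filter (fun f => Γ.s f = v), R f * star (R f) = 1) := by
    intro v
    by_cases hv : ∃ e, Γ.s e = v
    · haveI : Nonempty {e // Γ.s e = v} := ⟨⟨hv.choose, hv.choose_spec⟩⟩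
      obtain ⟨T, hT, hT1⟩ := SeqOperators.exists_isometries {e // Γ.s e = v}
      refine ⟨fun e => if h : Γ.s e = v then T ⟨e, h⟩ else 0, fun e he => ?_, fun _ => ?_⟩
      · simp only [dif_pos he]
        rw [hT, if_pos rfl]
      · rw [← hT1, Finset.sum_subtype (p := fun e => Γ.s e = v) _ (by simp)]
        refine Finset.sum_congr rfl fun e _ => ?_
        simp only [dif_pos e.2]
    · exact ⟨fun _ => 0, fun e he => absurd ⟨e, he⟩ hv, fun h => absurd h hv⟩
  choose R hR1 hR2 using hR
  have hUU : ∀ v, star (U v) * U v = 1 := fun v => by rw [hU, if_pos rfl]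
  have hRR : ∀ e, star (R (Γ.s e) e) * R (Γ.s e) e = 1 := fun e => hR1 _ e rfl
  -- `T e` is an isometry of the whole space into the range of `p (s e)`. Precomposition with the
  -- adjoint of `U (r e)` gives a partial isometry with initial projection `p (r e)`.
  let T : E → SeqOperators.{u} := fun e => U (Γ.s e) * R (Γ.s e) e
  have hTT : ∀ e, star (T e) * T e = 1 := fun e => by
    change star (U (Γ.s e) * R (Γ.s e) e) * (U (Γ.s e) * R (Γ.s e) e) = 1
    rw [star_mul, mul_assoc, ← mul_assoc (star (U _)), hUU, one_mul, hRR]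
  have hSS : ∀ e, T e * star (U (Γ.r e)) * star (T e * star (U (Γ.r e))) = T e * star (T e) :=
    fun e => by
      rw [star_mul, star_star, mul_assoc, ← mul_assoc (star (U _)), hUU, one_mul]
  refine ⟨fun v => U v * star (U v), fun e => T e * star (U (Γ.r e)), ?_, fun v hv => ?_⟩
  · constructor
    · intro v; rw [star_mul, star_star]
    · intro v w
      rw [mul_assoc, ← mul_assoc (star (U v)), hU]
      split_ifs with h
      · rw [one_mul, h]
      · rw [zero_mul, mul_zero]
    · exact hU1
    · intro e
      rw [hSS, mul_assoc, ← mul_assoc (star (T e)), hTT, one_mul]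
    · intro e
      rw [star_mul, star_star, mul_assoc, ← mul_assoc (star (T e)), hTT, one_mul]
    · intro v hv
      simp only [hSS]
      have : ∀ f ∈ Finset.univ.filter (fun f => Γ.s f = v),
          T f * star (T f) = U v * (R v f * star (R v f)) * star (U v) := fun f hf => by
        have hf : Γ.s f = v := by simpa using hf
        change U (Γ.s f) * R (Γ.s f) f * star (U (Γ.s f) * R (Γ.s f) f) = _
        rw [star_mul, hf]
        simp only [mul_assoc]
      rw [Finset.sum_congr (by congr) this, ← Finset.sum_mul, ← Finset.mul_sum, hR2 v hv, mul_one]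
  · have h1 : star (U v) * (U v * star (U v)) * U v = 1 := by
      rw [← mul_assoc, hUU, one_mul, hUU]
    have hv' : U v * star (U v) = 0 := hv
    rw [hv', mul_zero, zero_mul] at h1
    exact zero_ne_one h1

/-- The universal property maps `Γ.p v` to a projection of a concrete family, which is non-zero. -/
theorem p_ne_zero (v : V) : Γ.p v ≠ 0 := by
  have : Nonempty V := ⟨v⟩
  obtain ⟨p, S, h, hp⟩ := Γ.exists_isCKFamily
  intro h0
  have := Γ.ckRelations.lift_gen (Sum.elim p S) h (Sum.inl v)
  refine hp v (this.symm.trans ?_)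
  change Γ.ckRelations.lift (Sum.elim p S) h (Γ.p v) = 0
  rw [h0, map_zero]

theorem exists_functional (v : V) : ∃ ω : Γ.CStar →L[ℂ] ℂ, ω (Γ.p v) = 1 :=
  SeparatingDual.exists_eq_one (Γ.p_ne_zero v)

/-- A bounded functional with value `1` at the projection `p v`. -/
def vertexFunctional (v : V) : Γ.CStar →L[ℂ] ℂ := (Γ.exists_functional v).choose

theorem vertexFunctional_p (v : V) : Γ.vertexFunctional v (Γ.p v) = 1 :=
  (Γ.exists_functional v).choose_spec

/-- The functional that reads off the coefficient of `S e`. -/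
def edgeFunctional (e : E) : Γ.CStar →L[ℂ] ℂ :=
  (Γ.vertexFunctional (Γ.r e)).comp (ContinuousLinearMap.mul ℂ Γ.CStar (star (Γ.S e)))

-- Orthogonality of the ranges isolates the coefficient, and `ω (p (r e)) = 1` normalises it.
-- Slicing by these functionals recovers the matrix coefficients of a linear action.
open Classical in
theorem edgeFunctional_S (e f : E) : Γ.edgeFunctional e (Γ.S f) = if e = f then 1 else 0 := by
  change Γ.vertexFunctional (Γ.r e) (star (Γ.S e) * Γ.S f) = _
  rw [Γ.isCKFamily_canonical.star_S_mul_S']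
  split_ifs
  · exact Γ.vertexFunctional_p _
  · exact map_zero _

/-- The linear functional `x ↦ ∑ ω(p u x p u) + ∑ ω(S e* x S e)`, where `u` runs through the
vertices that emit no edge and `e` through the edges. -/
def tauExt : Γ.CStar →ₗ[ℂ] ℂ :=
  open Classical in
  ∑ u ∈ Finset.univ.filter (fun u => ∀ e, Γ.s e ≠ u),
    (Γ.vertexFunctional u : Γ.CStar →ₗ[ℂ] ℂ) ∘ₗ LinearMap.mulLeft ℂ (Γ.p u) ∘ₗ
      LinearMap.mulRight ℂ (Γ.p u) +
  ∑ e, (Γ.vertexFunctional (Γ.r e) : Γ.CStar →ₗ[ℂ] ℂ) ∘ₗ LinearMap.mulLeft ℂ (star (Γ.S e)) ∘ₗ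
      LinearMap.mulRight ℂ (Γ.S e)

open Classical in
theorem tauExt_apply (x : Γ.CStar) : Γ.tauExt x =
    ∑ u ∈ Finset.univ.filter (fun u => ∀ e, Γ.s e ≠ u),
      Γ.vertexFunctional u (Γ.p u * (x * Γ.p u)) +
    ∑ e, Γ.vertexFunctional (Γ.r e) (star (Γ.S e) * (x * Γ.S e)) := by
  simp [tauExt]

theorem tauExt_p (u : V) (hu : ∀ e, Γ.s e ≠ u) : Γ.tauExt (Γ.p u) = 1 := by
  classical
  have h := Γ.isCKFamily_canonical
  rw [tauExt_apply, Finset.sum_eq_single u, Finset.sum_eq_zero, add_zero]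
  · rw [h.p_mul_p, if_pos rfl, h.p_mul_p, if_pos rfl, vertexFunctional_p]
  · intro e _
    rw [h.p_mul_S_of_ne (hu e), mul_zero, map_zero]
  · intro v _ hv
    rw [← mul_assoc, h.p_mul_p, if_neg hv, zero_mul, map_zero]
  · intro h'
    simp [hu] at h'

-- Among the compressions `S g* (S e S f*) S g` only `g = e` can survive, and then only if `e = f`,
-- leaving `p (r e)`. The vertices in the first sum emit no edge, so they contribute nothing.
open Classical in
theorem tauExt_S_mul_star (e f : E) :
    Γ.tauExt (Γ.S e * star (Γ.S f)) = if e = f then 1 else 0 := by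
  have h := Γ.isCKFamily_canonical
  rw [tauExt_apply, Finset.sum_eq_zero, zero_add, Finset.sum_eq_single e]
  · rw [mul_assoc, ← mul_assoc, h.star_S_mul_S, h.star_S_mul_S']
    split_ifs with h1 h2 h2
    · rw [← h1, h.p_mul_p, if_pos rfl, vertexFunctional_p]
    · exact absurd h1.symm h2
    · exact absurd h2.symm h1
    · rw [mul_zero, map_zero]
  · intro g _ hg
    rw [← mul_assoc, ← mul_assoc, h.star_S_mul_S_of_ne hg, zero_mul, zero_mul, map_zero]
  · simp
  · intro u hu
    rw [← mul_assoc, ← mul_assoc, h.p_mul_S_of_ne ((Finset.mem_filter.1 hu).2 e), zero_mul,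
      zero_mul, map_zero]

/-- The functional `τ` on `V_{2,+}`. -/
def tau : Γ.V2plus →ₗ[ℂ] ℂ := Γ.tauExt ∘ₗ Γ.V2plus.subtype

/-- Since `τ` is restricted from a functional on the whole algebra, the prescribed values need no
check against linear relations among the spanning elements. -/
theorem isTau_tau : Γ.IsTau Γ.tau := by
  refine ⟨fun x u hu hx => ?_, fun x e f _ hx => ?_⟩
  · change Γ.tauExt x = 1
    rw [hx, Γ.tauExt_p u hu]
  · change Γ.tauExt x = _
    rw [hx, Γ.tauExt_S_mul_star]

end DirectedGraph

/-! ### Group-like unitaries of the free product of circles and its doubling -/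

namespace FreeCircles

variable {E : Type u}

/-- Group-like unitaries. -/
structure IsGroupLike (u : FreeCircles E) : Prop where
  star_mul : star u * u = 1
  mul_star : u * star u = 1
  comul_eq : comul E u = MinTensor.tmul u u

theorem isGroupLike_z (e : E) : IsGroupLike (z e) :=
  ⟨(z_unitary e).1, (z_unitary e).2, comul_z e⟩

theorem isGroupLike_one : IsGroupLike (1 : FreeCircles E) :=
  ⟨by simp, by simp, by rw [map_one, MinTensor.one_def]⟩

theorem IsGroupLike.star {u : FreeCircles E} (h : IsGroupLike u) : IsGroupLike (star u) :=
  ⟨by rw [star_star, h.mul_star], by rw [star_star, h.star_mul],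
    by rw [map_star, h.comul_eq, MinTensor.star_tmul]⟩

/-- The group-like unitaries span a dense subalgebra. -/
theorem induction_groupLike {P : FreeCircles E → Prop} (hclosed : IsClosed {x | P x})
    (hgl : ∀ u, IsGroupLike u → P u) (hsmul : ∀ (c : ℂ) a, P a → P (c • a))
    (hmul : ∀ a b, P a → P b → P (a * b)) (hadd : ∀ a b, P a → P b → P (a + b))
    (a : FreeCircles E) : P a :=
  (unitaryRelations E).univ_induction hclosed (hgl _ isGroupLike_one)
    (fun e => hgl _ (isGroupLike_z e)) (fun e => hgl _ (isGroupLike_z e).star) hsmul hmul hadd a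

/-- On a group-like `u`, coassociativity compares two forms of `u ⊗ u ⊗ u`, and the density axioms
follow from `Δ(u)(1 ⊗ u*) = u ⊗ 1` and `Δ(u)(u* ⊗ 1) = 1 ⊗ u`. -/
theorem isCompactQuantumGroup : IsCompactQuantumGroup (comul E) where
  coassoc := by
    refine induction_groupLike (MinTensor.isClosed_assocRel
        ((MinTensor.continuous_map _ _).comp (StarAlgHom.continuous_of_cstar _))
        ((MinTensor.continuous_map _ _).comp (StarAlgHom.continuous_of_cstar _))) ?_ ?_ ?_ ?_
    · intro u hu
      rw [hu.comul_eq, MinTensor.map_tmul, MinTensor.map_tmul]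
      change MinTensor.AssocRel (MinTensor.tmul (comul E u) u) (MinTensor.tmul u (comul E u))
      rw [hu.comul_eq]
      exact MinTensor.AssocRel.tmul _ _ _
    · intro c a h
      simp only [map_smul]
      exact h.smul c
    · intro a b ha hb
      simp only [map_mul]
      exact ha.mul hb
    · intro a b ha hb
      simp only [map_add]
      exact ha.add hb
  dense_right := by
    refine MinTensor.dense_span_mul_one_tmul _ (induction_groupLike
      ((isClosed_closedProductSpan _ _).preimage (MinTensor.continuous_tmul_left _)) ?_ ?_ ?_ ?_)
    · intro u hu
      have := mem_closedProductSpan (comul E)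
        (fun b => MinTensor.tmul (1 : FreeCircles E) b) u (star u)
      rwa [hu.comul_eq, MinTensor.tmul_mul_tmul, mul_one, hu.mul_star] at this
    · intro c a h
      rw [MinTensor.smul_tmul]
      exact Submodule.smul_mem _ _ h
    · exact fun a b ha hb => MinTensor.tmul_one_mul_mem _ ha hb
    · intro a b ha hb
      rw [MinTensor.add_tmul]
      exact add_mem ha hb
  dense_left := by
    refine MinTensor.dense_span_mul_tmul_one _ (induction_groupLike
      ((isClosed_closedProductSpan _ _).preimage (MinTensor.continuous_tmul_right _)) ?_ ?_ ?_ ?_)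
    · intro u hu
      have := mem_closedProductSpan (comul E)
        (fun b => MinTensor.tmul b (1 : FreeCircles E)) u (star u)
      rwa [hu.comul_eq, MinTensor.tmul_mul_tmul, mul_one, hu.mul_star] at this
    · intro c a h
      rw [MinTensor.tmul_smul]
      exact Submodule.smul_mem _ _ h
    · exact fun a b ha hb => MinTensor.one_tmul_mul_mem _ ha hb
    · intro a b ha hb
      rw [MinTensor.tmul_add]
      exact add_mem ha hb

/-! #### Automorphisms that permute the generators -/

/-- The endomorphism induced by a permutation of the generators. -/
def permHom (σ : Equiv.Perm E) : FreeCircles E →⋆ₐ[ℂ] FreeCircles E :=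
  (unitaryRelations E).lift (fun e => z (σ e)) fun e => z_unitary (σ e)

theorem permHom_z (σ : Equiv.Perm E) (e : E) : permHom σ (z e) = z (σ e) :=
  (unitaryRelations E).lift_gen _ _ e

theorem hom_ext {B : Type u} [CStarAlgebra B] {f g : FreeCircles E →⋆ₐ[ℂ] B}
    (h : ∀ e, f (z e) = g (z e)) (a : FreeCircles E) : f a = g a :=
  (unitaryRelations E).univ_hom_ext (f : FreeCircles E →⋆ₙₐ[ℂ] B) (g : FreeCircles E →⋆ₙₐ[ℂ] B)
    ((map_one f).trans (map_one g).symm) h a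

theorem permHom_permHom {σ : Equiv.Perm E} (hσ : ∀ e, σ (σ e) = e) (a : FreeCircles E) :
    permHom σ (permHom σ a) = a :=
  hom_ext (f := (permHom σ).comp (permHom σ)) (g := StarAlgHom.id ℂ _) (fun e => by
    change permHom σ (permHom σ (z e)) = z e
    rw [permHom_z, permHom_z, hσ]) a

/-- The automorphism induced by an involution of the set of generators. -/
def permEquiv (σ : Equiv.Perm E) (hσ : ∀ e, σ (σ e) = e) : FreeCircles E ≃⋆ₐ[ℂ] FreeCircles E :=
  StarAlgEquiv.ofAlgEquiv (AlgEquiv.ofAlgHom (permHom σ).toAlgHom (permHom σ).toAlgHom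
    (AlgHom.ext (permHom_permHom hσ)) (AlgHom.ext (permHom_permHom hσ))) (map_star (permHom σ))

theorem isCQGMorphism_permHom (σ : Equiv.Perm E) :
    IsCQGMorphism (comul E) (comul E) (permHom σ) := by
  intro a
  refine (unitaryRelations E).univ_hom_ext
    ((MinTensor.map (permHom σ : FreeCircles E →⋆ₙₐ[ℂ] FreeCircles E)
      (permHom σ : FreeCircles E →⋆ₙₐ[ℂ] FreeCircles E)).comp
      (comul E : FreeCircles E →⋆ₙₐ[ℂ] _))
    ((comul E : FreeCircles E →⋆ₙₐ[ℂ] _).comp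
      (permHom σ : FreeCircles E →⋆ₙₐ[ℂ] FreeCircles E)) ?_ ?_ a
  · change MinTensor.map (permHom σ : FreeCircles E →⋆ₙₐ[ℂ] FreeCircles E)
      (permHom σ : FreeCircles E →⋆ₙₐ[ℂ] FreeCircles E) (comul E 1) = comul E (permHom σ 1)
    rw [map_one (comul E), map_one (permHom σ), map_one (comul E), MinTensor.one_def, MinTensor.map_tmul]
    change MinTensor.tmul (permHom σ 1) (permHom σ 1) = _
    rw [map_one (permHom σ)]
  · intro e
    change MinTensor.map (permHom σ : FreeCircles E →⋆ₙₐ[ℂ] FreeCircles E)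
      (permHom σ : FreeCircles E →⋆ₙₐ[ℂ] FreeCircles E) (comul E (z e)) =
      comul E (permHom σ (z e))
    rw [comul_z, MinTensor.map_tmul, permHom_z, comul_z]
    change MinTensor.tmul (permHom σ (z e)) (permHom σ (z e)) = _
    rw [permHom_z]

theorem IsGroupLike.permHom {u : FreeCircles E} (h : IsGroupLike u) (σ : Equiv.Perm E) :
    IsGroupLike (permHom σ u) :=
  ⟨by rw [← map_star, ← map_mul, h.star_mul, map_one],
    by rw [← map_star, ← map_mul, h.mul_star, map_one],
    by rw [← isCQGMorphism_permHom σ u, h.comul_eq, MinTensor.map_tmul]; rfl⟩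

/-! #### The doubling -/

/-- Each summand is treated by induction on the free product. The units `(1, 0)` and `(0, 1)` are
separate hypotheses because neither is the unit of the direct sum. -/
theorem prod_induction {P : FreeCircles E × FreeCircles E → Prop}
    (hclosed : IsClosed {x | P x}) (hone : P (1, 0)) (hone' : P (0, 1))
    (hz : ∀ e, P (z e, 0)) (hz' : ∀ e, P (0, z e)) (hstar : ∀ e, P (star (z e), 0))
    (hstar' : ∀ e, P (0, star (z e))) (hsmul : ∀ (c : ℂ) a, P a → P (c • a))
    (hmul : ∀ a b, P a → P b → P (a * b)) (hadd : ∀ a b, P a → P b → P (a + b))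
    (x : FreeCircles E × FreeCircles E) : P x := by
  have h1 : ∀ a : FreeCircles E, P (a, 0) := (unitaryRelations E).univ_induction
    (hclosed.preimage (continuous_id.prodMk continuous_const)) hone hz hstar
    (fun c a h => by have := hsmul c _ h; rwa [Prod.smul_mk, smul_zero] at this)
    (fun a b ha hb => by have := hmul _ _ ha hb; rwa [Prod.mk_mul_mk, mul_zero] at this)
    (fun a b ha hb => by have := hadd _ _ ha hb; rwa [Prod.mk_add_mk, add_zero] at this)
  have h2 : ∀ a : FreeCircles E, P (0, a) := (unitaryRelations E).univ_induction
    (hclosed.preimage (continuous_const.prodMk continuous_id)) hone' hz' hstar'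
    (fun c a h => by have := hsmul c _ h; rwa [Prod.smul_mk, smul_zero] at this)
    (fun a b ha hb => by have := hmul _ _ ha hb; rwa [Prod.mk_mul_mk, mul_zero] at this)
    (fun a b ha hb => by have := hadd _ _ ha hb; rwa [Prod.mk_add_mk, add_zero] at this)
  have := hadd _ _ (h1 x.1) (h2 x.2)
  rwa [Prod.mk_add_mk, add_zero, zero_add] at this

theorem prod_induction_groupLike {P : FreeCircles E × FreeCircles E → Prop}
    (hclosed : IsClosed {x | P x}) (hzeta : ∀ u, IsGroupLike u → P (u, 0))
    (heta : ∀ u, IsGroupLike u → P (0, u)) (hsmul : ∀ (c : ℂ) a, P a → P (c • a))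
    (hmul : ∀ a b, P a → P b → P (a * b)) (hadd : ∀ a b, P a → P b → P (a + b))
    (x : FreeCircles E × FreeCircles E) : P x :=
  prod_induction hclosed (hzeta _ isGroupLike_one) (heta _ isGroupLike_one)
    (fun e => hzeta _ (isGroupLike_z e)) (fun e => heta _ (isGroupLike_z e))
    (fun e => hzeta _ (isGroupLike_z e).star) (fun e => heta _ (isGroupLike_z e).star)
    hsmul hmul hadd x

/-- The comultiplication of the doubling by a permutation of the generators. -/
abbrev doubledComul (σ : Equiv.Perm E) := doublingComul (comul E) (permHom σ)

variable {σ : Equiv.Perm E}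

/-- The second leg is twisted by `σ` exactly when the first leg lies in the second summand; this
twist breaks cocommutativity later. -/
theorem IsGroupLike.doubledComul_zeta {u : FreeCircles E} (h : IsGroupLike u) :
    doubledComul σ (u, 0) = MinTensor.tmul (u, 0) (u, 0) +
      MinTensor.tmul (0, u) (0, FreeCircles.permHom σ u) := by
  refine (doublingComul_zeta (comul E) (FreeCircles.permHom σ) u).trans ?_
  rw [h.comul_eq, MinTensor.map_tmul, MinTensor.map_tmul]
  rfl

theorem IsGroupLike.doubledComul_eta {u : FreeCircles E} (h : IsGroupLike u) :
    doubledComul σ (0, u) = MinTensor.tmul (u, 0) (0, u) +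
      MinTensor.tmul (0, u) (FreeCircles.permHom σ u, 0) := by
  refine (doublingComul_eta (comul E) (FreeCircles.permHom σ) u).trans ?_
  rw [h.comul_eq, MinTensor.map_tmul, MinTensor.map_tmul]
  rfl

theorem tmul_one_eq {A : Type u} [CStarAlgebra A] (a : A) :
    MinTensor.tmul a (1 : FreeCircles E × FreeCircles E) =
      MinTensor.tmul a (1, 0) + MinTensor.tmul a (0, 1) := by
  rw [← MinTensor.tmul_add, Prod.mk_add_mk, add_zero, zero_add, ← Prod.one_eq_mk]

theorem one_tmul_eq {A : Type u} [CStarAlgebra A] (a : A) :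
    MinTensor.tmul (1 : FreeCircles E × FreeCircles E) a =
      MinTensor.tmul (1, 0) a + MinTensor.tmul (0, 1) a := by
  rw [← MinTensor.add_tmul, Prod.mk_add_mk, add_zero, zero_add, ← Prod.one_eq_mk]

/-- On `(u, 0)` and `(0, u)` with `u` group-like, both iterated comultiplications are sums of the
same four elementary tensors once `σ² = id` is used. For density, one takes the comultiplications of
two elements and multiplies each by an element killing one of its two terms. -/
theorem isCompactQuantumGroup_doubling (hσ : ∀ e, σ (σ e) = e) :
    IsCompactQuantumGroup (doubledComul σ) where
  coassoc := by
    have coeId : ∀ x, (NonUnitalStarAlgHom.id ℂ (FreeCircles E × FreeCircles E)) x = x :=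
      fun _ => rfl
    have coeΔ : ∀ x, (doubledComul σ : FreeCircles E × FreeCircles E →⋆ₙₐ[ℂ] _) x =
      doubledComul σ x := fun _ => rfl
    refine prod_induction_groupLike (MinTensor.isClosed_assocRel
        ((MinTensor.continuous_map _ _).comp (StarAlgHom.continuous_of_cstar _))
        ((MinTensor.continuous_map _ _).comp (StarAlgHom.continuous_of_cstar _))) ?_ ?_ ?_ ?_ ?_
    · intro u hu
      rw [hu.doubledComul_zeta, map_add, map_add]
      simp only [MinTensor.map_tmul, coeId, coeΔ, hu.doubledComul_zeta, hu.doubledComul_eta,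
        (hu.permHom σ).doubledComul_eta, permHom_permHom hσ, MinTensor.add_tmul,
        MinTensor.tmul_add]
      -- The four terms on the left occur on the right in the order first, third, fourth, second.
      rw [add_add_add_comm]
      refine ((MinTensor.AssocRel.tmul _ _ _).add (MinTensor.AssocRel.tmul _ _ _)).add ?_
      rw [add_comm]
      exact (MinTensor.AssocRel.tmul _ _ _).add (MinTensor.AssocRel.tmul _ _ _)
    · intro u hu
      rw [hu.doubledComul_eta, map_add, map_add]
      simp only [MinTensor.map_tmul, coeId, coeΔ, hu.doubledComul_zeta, hu.doubledComul_eta,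
        (hu.permHom σ).doubledComul_zeta, permHom_permHom hσ, MinTensor.add_tmul,
        MinTensor.tmul_add]
      rw [add_add_add_comm]
      refine ((MinTensor.AssocRel.tmul _ _ _).add (MinTensor.AssocRel.tmul _ _ _)).add ?_
      rw [add_comm]
      exact (MinTensor.AssocRel.tmul _ _ _).add (MinTensor.AssocRel.tmul _ _ _)
    · intro c a h
      simp only [map_smul]
      exact h.smul c
    · intro a b ha hb
      simp only [map_mul]
      exact ha.mul hb
    · intro a b ha hb
      simp only [map_add]
      exact ha.add hb
  dense_right := by
    refine MinTensor.dense_span_mul_one_tmul _ (prod_induction_groupLike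
      ((isClosed_closedProductSpan _ _).preimage (MinTensor.continuous_tmul_left _)) ?_ ?_ ?_ ?_ ?_)
    · intro u hu
      -- `(u, 0) ⊗ 1 = Δ(u, 0)(1 ⊗ (u*, 0)) + Δ(0, u)(1 ⊗ (0, u*))`, the halves `⊗ (1, 0)` and `⊗
      -- (0, 1)` arising separately.
      have h1 := mem_closedProductSpan (doubledComul σ)
        (fun b => MinTensor.tmul (1 : FreeCircles E × FreeCircles E) b) (u, 0) (star u, 0)
      have h2 := mem_closedProductSpan (doubledComul σ)
        (fun b => MinTensor.tmul (1 : FreeCircles E × FreeCircles E) b) (0, u) (0, star u)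
      simp only [hu.doubledComul_zeta, hu.doubledComul_eta, add_mul, MinTensor.tmul_mul_tmul,
        mul_one, Prod.mk_mul_mk, hu.mul_star, mul_zero, zero_mul, Prod.mk_zero_zero,
        MinTensor.tmul_zero, add_zero] at h1 h2
      rw [tmul_one_eq]
      exact add_mem h1 h2
    · intro u hu
      -- Where the first leg is `(0, u)` the second leg carries `σ u`, so that is the unitary to
      -- cancel.
      have h1 := mem_closedProductSpan (doubledComul σ)
        (fun b => MinTensor.tmul (1 : FreeCircles E × FreeCircles E) b) (u, 0)
        (0, star (permHom σ u))
      have h2 := mem_closedProductSpan (doubledComul σ)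
        (fun b => MinTensor.tmul (1 : FreeCircles E × FreeCircles E) b) (0, u)
        (star (permHom σ u), 0)
      simp only [hu.doubledComul_zeta, hu.doubledComul_eta, add_mul, MinTensor.tmul_mul_tmul,
        mul_one, Prod.mk_mul_mk, (hu.permHom σ).mul_star, mul_zero, zero_mul, Prod.mk_zero_zero,
        MinTensor.tmul_zero, zero_add] at h1 h2
      rw [tmul_one_eq]
      exact add_mem h2 h1
    · intro c a h
      rw [MinTensor.smul_tmul]
      exact Submodule.smul_mem _ _ h
    · exact fun a b ha hb => MinTensor.tmul_one_mul_mem _ ha hb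
    · intro a b ha hb
      rw [MinTensor.add_tmul]
      exact add_mem ha hb
  dense_left := by
    refine MinTensor.dense_span_mul_tmul_one _ (prod_induction_groupLike
      ((isClosed_closedProductSpan _ _).preimage (MinTensor.continuous_tmul_right _))
      ?_ ?_ ?_ ?_ ?_)
    · intro u hu
      -- Starting from `σ u` compensates the twist: the second leg then carries `σ (σ u) = u`.
      have hv := hu.permHom σ
      have h1 := mem_closedProductSpan (doubledComul σ)
        (fun b => MinTensor.tmul b (1 : FreeCircles E × FreeCircles E)) (u, 0) (star u, 0)
      have h2 := mem_closedProductSpan (doubledComul σ)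
        (fun b => MinTensor.tmul b (1 : FreeCircles E × FreeCircles E)) (0, permHom σ u)
        (0, star (permHom σ u))
      simp only [hu.doubledComul_zeta, hv.doubledComul_eta, add_mul, MinTensor.tmul_mul_tmul,
        mul_one, Prod.mk_mul_mk, hu.mul_star, hv.mul_star, mul_zero, zero_mul, Prod.mk_zero_zero,
        MinTensor.zero_tmul, add_zero, zero_add, permHom_permHom hσ] at h1 h2
      rw [one_tmul_eq]
      exact add_mem h1 h2
    · intro u hu
      have hv := hu.permHom σ
      have h1 := mem_closedProductSpan (doubledComul σ)
        (fun b => MinTensor.tmul b (1 : FreeCircles E × FreeCircles E)) (0, u) (star u, 0)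
      have h2 := mem_closedProductSpan (doubledComul σ)
        (fun b => MinTensor.tmul b (1 : FreeCircles E × FreeCircles E)) (permHom σ u, 0)
        (0, star (permHom σ u))
      simp only [hu.doubledComul_eta, hv.doubledComul_zeta, add_mul, MinTensor.tmul_mul_tmul,
        mul_one, Prod.mk_mul_mk, hu.mul_star, hv.mul_star, mul_zero, zero_mul, Prod.mk_zero_zero,
        MinTensor.zero_tmul, add_zero, zero_add, permHom_permHom hσ] at h1 h2
      rw [one_tmul_eq]
      exact add_mem h1 h2
    · intro c a h
      rw [MinTensor.tmul_smul]
      exact Submodule.smul_mem _ _ h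
    · exact fun a b ha hb => MinTensor.one_tmul_mul_mem _ ha hb
    · intro a b ha hb
      rw [MinTensor.tmul_add]
      exact add_mem ha hb

end FreeCircles

/-! ### The action of the doubling on the graph C*-algebra -/

namespace DirectedGraph

open FreeCircles

variable {V E : Type u} [Fintype V] [Fintype E] (Γ : DirectedGraph V E)

/-- A permutation of the edges that preserves sources and ranges. -/
structure IsEdgeSymmetry (σ : Equiv.Perm E) : Prop where
  invol : ∀ e, σ (σ e) = e
  s_eq : ∀ e, Γ.s (σ e) = Γ.s e
  r_eq : ∀ e, Γ.r (σ e) = Γ.r e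

/-- The value of the action of the doubling at `S e`. -/
def edgeImage (σ : Equiv.Perm E) (e : E) :
    MinTensor Γ.CStar (FreeCircles E × FreeCircles E) :=
  MinTensor.tmul (Γ.S e) (z e, 0) + MinTensor.tmul (Γ.S (σ e)) (0, z (σ e))

theorem edgeImage_mul_star (σ : Equiv.Perm E) (e f : E) :
    Γ.edgeImage σ e * star (Γ.edgeImage σ f) =
      MinTensor.tmul (Γ.S e * star (Γ.S f)) (z e * star (z f), 0) +
      MinTensor.tmul (Γ.S (σ e) * star (Γ.S (σ f))) (0, z (σ e) * star (z (σ f))) := by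
  simp only [edgeImage, star_add, MinTensor.star_tmul, add_mul, mul_add, MinTensor.tmul_mul_tmul,
    Prod.star_def, Prod.mk_mul_mk, star_zero, mul_zero, zero_mul, Prod.mk_zero_zero,
    MinTensor.tmul_zero, add_zero, zero_add]

variable {Γ} {σ : Equiv.Perm E}

/-- The two terms of `edgeImage` have orthogonal second legs, so the relations split. The first half
is the original family rotated by unitaries; the second is its permutation by `σ`, for which the
relations persist because `σ` preserves sources and ranges. -/
theorem IsEdgeSymmetry.isCKFamily (h : Γ.IsEdgeSymmetry σ) :
    Γ.IsCKFamily (fun v => MinTensor.tmul (Γ.p v) (1 : FreeCircles E × FreeCircles E))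
      (Γ.edgeImage σ) := by
  classical
  have hc := Γ.isCKFamily_canonical
  have hSS : ∀ e, Γ.edgeImage σ e * star (Γ.edgeImage σ e) =
      MinTensor.tmul (Γ.S e * star (Γ.S e)) (1, 0) +
      MinTensor.tmul (Γ.S (σ e) * star (Γ.S (σ e))) (0, 1) := fun e => by
    rw [edgeImage_mul_star, (z_unitary _).2, (z_unitary _).2]
  constructor
  · intro v
    rw [MinTensor.star_tmul, hc.star_p, star_one]
  · intro v w
    rw [MinTensor.tmul_mul_tmul, hc.p_mul_p, mul_one]
    split_ifs
    · rfl
    · exact MinTensor.zero_tmul _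
  · rw [← MinTensor.sum_tmul, hc.sum_p, MinTensor.one_def]
  · intro e
    rw [hSS, edgeImage]
    simp only [add_mul, mul_add, MinTensor.tmul_mul_tmul, Prod.mk_mul_mk, mul_zero, zero_mul,
      Prod.mk_zero_zero, MinTensor.tmul_zero, add_zero, zero_add, one_mul, hc.partialIsometry]
  · intro e
    simp only [edgeImage, star_add, MinTensor.star_tmul, add_mul, mul_add,
      MinTensor.tmul_mul_tmul, Prod.star_def, Prod.mk_mul_mk, star_zero, mul_zero, zero_mul,
      Prod.mk_zero_zero, MinTensor.tmul_zero, add_zero, zero_add, (z_unitary _).1,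
      hc.star_S_mul_S, h.r_eq]
    rw [tmul_one_eq]
  · intro v hv
    simp only [hSS]
    rw [Finset.sum_add_distrib, tmul_one_eq, hc.sum_S_mul_star v hv, MinTensor.sum_tmul,
      MinTensor.sum_tmul]
    refine congrArg₂ _ (Finset.sum_congr (by congr) fun _ _ => rfl) ?_
    -- `σ` permutes the edges with source `v`.
    refine Finset.sum_equiv σ (fun e => ?_) fun e _ => ?_
    · simp [h.s_eq]
    · rw [h.invol]

/-- The action of the doubling on the graph C*-algebra. -/
def doubledAction (h : Γ.IsEdgeSymmetry σ) :
    Γ.CStar →⋆ₐ[ℂ] MinTensor Γ.CStar (FreeCircles E × FreeCircles E) :=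
  Γ.ckRelations.lift (Sum.elim (fun v => MinTensor.tmul (Γ.p v) 1) (Γ.edgeImage σ)) h.isCKFamily

namespace IsEdgeSymmetry

variable (h : Γ.IsEdgeSymmetry σ)

theorem action_p (v : V) : Γ.doubledAction h (Γ.p v) = MinTensor.tmul (Γ.p v) 1 :=
  Γ.ckRelations.lift_gen
    (Sum.elim (fun v => MinTensor.tmul (Γ.p v) 1) (Γ.edgeImage σ)) h.isCKFamily (Sum.inl v)

theorem action_S (e : E) : Γ.doubledAction h (Γ.S e) =
    MinTensor.tmul (Γ.S e) (z e, 0) + MinTensor.tmul (Γ.S (σ e)) (0, z (σ e)) :=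
  Γ.ckRelations.lift_gen
    (Sum.elim (fun v => MinTensor.tmul (Γ.p v) 1) (Γ.edgeImage σ)) h.isCKFamily (Sum.inr e)

theorem action_coassoc (x : Γ.CStar) : MinTensor.AssocRel
    (MinTensor.map (Γ.doubledAction h : Γ.CStar →⋆ₙₐ[ℂ]
        MinTensor Γ.CStar (FreeCircles E × FreeCircles E)) (NonUnitalStarAlgHom.id ℂ (FreeCircles E × FreeCircles E))
      (Γ.doubledAction h x))
    (MinTensor.map (NonUnitalStarAlgHom.id ℂ Γ.CStar)
      (doubledComul σ : FreeCircles E × FreeCircles E →⋆ₙₐ[ℂ]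
        MinTensor (FreeCircles E × FreeCircles E) (FreeCircles E × FreeCircles E)) (Γ.doubledAction h x)) := by
  have coeα : ∀ x, (Γ.doubledAction h : Γ.CStar →⋆ₙₐ[ℂ]
        MinTensor Γ.CStar (FreeCircles E × FreeCircles E)) x = Γ.doubledAction h x := fun _ => rfl
  have coeId : ∀ x, (NonUnitalStarAlgHom.id ℂ (FreeCircles E × FreeCircles E)) x = x :=
    fun _ => rfl
  have coeId' : ∀ x, (NonUnitalStarAlgHom.id ℂ Γ.CStar) x = x := fun _ => rfl
  have coeΔ : ∀ x, (doubledComul σ : FreeCircles E × FreeCircles E →⋆ₙₐ[ℂ]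
        MinTensor (FreeCircles E × FreeCircles E) (FreeCircles E × FreeCircles E)) x =
    doubledComul σ x := fun _ => rfl
  let P : Γ.CStar → Prop := fun x => MinTensor.AssocRel
    (MinTensor.map (Γ.doubledAction h : Γ.CStar →⋆ₙₐ[ℂ]
        MinTensor Γ.CStar (FreeCircles E × FreeCircles E))
      (NonUnitalStarAlgHom.id ℂ (FreeCircles E × FreeCircles E)) (Γ.doubledAction h x))
    (MinTensor.map (NonUnitalStarAlgHom.id ℂ Γ.CStar)
      (doubledComul σ : FreeCircles E × FreeCircles E →⋆ₙₐ[ℂ]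
        MinTensor (FreeCircles E × FreeCircles E) (FreeCircles E × FreeCircles E))
      (Γ.doubledAction h x))
  have hgen : ∀ x, P (Γ.ckRelations.gen x) := by
    rintro (v | e)
    · change MinTensor.AssocRel (MinTensor.map _ _ (Γ.doubledAction h (Γ.p v)))
        (MinTensor.map _ _ (Γ.doubledAction h (Γ.p v)))
      rw [action_p, MinTensor.map_tmul, MinTensor.map_tmul, coeα, coeΔ, action_p,
        map_one (doubledComul σ), MinTensor.one_def]
      exact MinTensor.AssocRel.tmul _ _ _
    · change MinTensor.AssocRel (MinTensor.map _ _ (Γ.doubledAction h (Γ.S e)))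
        (MinTensor.map _ _ (Γ.doubledAction h (Γ.S e)))
      rw [action_S, map_add, map_add]
      simp only [MinTensor.map_tmul, coeα, coeId, coeId', coeΔ, action_S,
        (isGroupLike_z _).doubledComul_zeta, (isGroupLike_z _).doubledComul_eta, permHom_z,
        h.invol, MinTensor.add_tmul, MinTensor.tmul_add]
      -- The four terms are listed in the order of the right-hand expansion; the left-hand one
      -- differs only by reordering.
      have key := ((MinTensor.AssocRel.tmul (Γ.S e) ((z e, 0) : FreeCircles E × FreeCircles E)
          ((z e, 0) : FreeCircles E × FreeCircles E)).add
        (MinTensor.AssocRel.tmul (Γ.S e) ((0, z e) : FreeCircles E × FreeCircles E)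
          ((0, z (σ e)) : FreeCircles E × FreeCircles E))).add
        ((MinTensor.AssocRel.tmul (Γ.S (σ e)) ((z (σ e), 0) : FreeCircles E × FreeCircles E)
          ((0, z (σ e)) : FreeCircles E × FreeCircles E)).add
        (MinTensor.AssocRel.tmul (Γ.S (σ e)) ((0, z (σ e)) : FreeCircles E × FreeCircles E)
          ((z e, 0) : FreeCircles E × FreeCircles E)))
      convert key using 1
      abel
  refine Γ.ckRelations.univ_induction (P := P) (MinTensor.isClosed_assocRel
      ((MinTensor.continuous_map _ _).comp (StarAlgHom.continuous_of_cstar _))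
      ((MinTensor.continuous_map _ _).comp (StarAlgHom.continuous_of_cstar _))) ?_ hgen ?_ ?_ ?_ ?_ x
  · simp only [P]
    rw [map_one (Γ.doubledAction h), MinTensor.one_def, MinTensor.map_tmul, MinTensor.map_tmul,
      coeα, coeΔ, map_one (Γ.doubledAction h), map_one (doubledComul σ), MinTensor.one_def,
      MinTensor.one_def]
    exact MinTensor.AssocRel.tmul _ _ _
  · intro x
    simp only [P, map_star]
    exact (hgen x).star
  · intro c a h
    simp only [P, map_smul]
    exact h.smul c
  · intro a b ha hb
    simp only [P, map_mul]
    exact ha.mul hb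
  · intro a b ha hb
    simp only [P, map_add]
    exact ha.add hb

/-- As for the density axioms of the doubling, it suffices to reach `x ⊗ 1` for `x` a generator or
its adjoint. -/
theorem action_dense : Dense (Submodule.span ℂ
    {y : MinTensor Γ.CStar (FreeCircles E × FreeCircles E) | ∃ (x : Γ.CStar) (b : _),
      y = Γ.doubledAction h x * MinTensor.tmul 1 b} : Set (MinTensor Γ.CStar (FreeCircles E × FreeCircles E))) := by
  -- `S e` occurs in the first summand of `α (S e)` and in the second summand of `α (S (σ e))`; the
  -- two pieces add up to `S e ⊗ 1`.
  have hS : ∀ e, Γ.doubledAction h (Γ.S e) * MinTensor.tmul 1 (star (z e), 0) +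
      Γ.doubledAction h (Γ.S (σ e)) * MinTensor.tmul 1 (0, star (z e)) =
      MinTensor.tmul (Γ.S e) 1 := fun e => by
    rw [action_S, action_S, h.invol, tmul_one_eq]
    simp only [add_mul, MinTensor.tmul_mul_tmul, mul_one, Prod.mk_mul_mk, (z_unitary _).2,
      mul_zero, zero_mul, Prod.mk_zero_zero, MinTensor.tmul_zero, add_zero, zero_add]
  -- Adjoints need their own formula, since taking adjoints in `α(x)(1 ⊗ b)` reverses the order of
  -- the factors.
  have hS' : ∀ e, Γ.doubledAction h (star (Γ.S e)) * MinTensor.tmul 1 (z e, 0) +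
      Γ.doubledAction h (star (Γ.S (σ e))) * MinTensor.tmul 1 (0, z e) =
      MinTensor.tmul (star (Γ.S e)) 1 := fun e => by
    rw [map_star, map_star, action_S, action_S, h.invol, tmul_one_eq]
    simp only [star_add, MinTensor.star_tmul, Prod.star_def, star_zero, add_mul,
      MinTensor.tmul_mul_tmul, mul_one, Prod.mk_mul_mk, (z_unitary _).1,
      mul_zero, zero_mul, Prod.mk_zero_zero, MinTensor.tmul_zero, add_zero, zero_add]
  have hmem := mem_closedProductSpan (Γ.doubledAction h)
    (fun b : FreeCircles E × FreeCircles E => MinTensor.tmul (1 : Γ.CStar) b)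
  have hp : ∀ v, MinTensor.tmul (Γ.p v) 1 ∈ closedProductSpan (Γ.doubledAction h)
      (fun b : FreeCircles E × FreeCircles E => MinTensor.tmul (1 : Γ.CStar) b) := fun v => by
    have := hmem (Γ.p v) 1
    rwa [action_p, MinTensor.tmul_mul_tmul, mul_one, mul_one] at this
  refine MinTensor.dense_span_mul_one_tmul _ (Γ.ckRelations.univ_induction
    ((isClosed_closedProductSpan _ _).preimage (MinTensor.continuous_tmul_left _))
    ?_ ?_ ?_ ?_ ?_ ?_)
  · have := hmem 1 1
    rwa [map_one, one_mul] at this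
  · rintro (v | e)
    · exact hp v
    · exact hS e ▸ add_mem (hmem _ _) (hmem _ _)
  · rintro (v | e)
    · have := hp v
      rw [← Γ.isCKFamily_canonical.star_p] at this
      exact this
    · exact hS' e ▸ add_mem (hmem _ _) (hmem _ _)
  · intro c a h
    rw [MinTensor.smul_tmul]
    exact Submodule.smul_mem _ _ h
  · exact fun a b ha hb => MinTensor.tmul_one_mul_mem _ ha hb
  · intro a b ha hb
    rw [MinTensor.add_tmul]
    exact add_mem ha hb

theorem isSlice_action_S (θ : Γ.CStar →L[ℂ] ℂ) (e : E) :
    MinTensor.IsSlice θ (Γ.doubledAction h (Γ.S e))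
      (θ (Γ.S e) • (z e, 0) + θ (Γ.S (σ e)) • (0, z (σ e))) := by
  refine subset_closure ⟨Γ.S e ⊗ₜ (z e, 0) + Γ.S (σ e) ⊗ₜ (0, z (σ e)), ?_⟩
  refine Prod.ext ?_ ?_
  · change MinTensor.ofAlg _ = _
    rw [map_add, action_S]
    rfl
  · simp

/-- A moved edge gives `(z e, 0)` and `(0, z e)` as separate coefficients, whereas a fixed edge
gives only `(z e, z e)`. The moved edge `e₀` therefore supplies the two central projections that
separate the remaining coefficients. -/
theorem action_faithful {e₀ : E} (he₀ : σ e₀ ≠ e₀) : Dense (StarAlgebra.adjoin ℂ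
    {b : FreeCircles E × FreeCircles E | ∃ (θ : Γ.CStar →L[ℂ] ℂ) (x : Γ.CStar),
      MinTensor.IsSlice θ (Γ.doubledAction h x) b} : Set (FreeCircles E × FreeCircles E)) := by
  classical
  set T := StarAlgebra.adjoin ℂ {b : FreeCircles E × FreeCircles E |
    ∃ (θ : Γ.CStar →L[ℂ] ℂ) (x : Γ.CStar), MinTensor.IsSlice θ (Γ.doubledAction h x) b} with hT
  have hmem : ∀ e k, (if k = e then (1 : ℂ) else 0) • ((z e, 0) : FreeCircles E × FreeCircles E) +
      (if k = σ e then (1 : ℂ) else 0) • (0, z (σ e)) ∈ T := fun e k => by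
    rw [← Γ.edgeFunctional_S, ← Γ.edgeFunctional_S]
    exact StarAlgebra.subset_adjoin ℂ _ ⟨Γ.edgeFunctional k, Γ.S e, h.isSlice_action_S _ e⟩
  have hfst : ∀ e, σ e ≠ e → ((z e, 0) : FreeCircles E × FreeCircles E) ∈ T := fun e he => by
    have := hmem e e
    rwa [if_pos rfl, if_neg he.symm, one_smul, zero_smul, add_zero] at this
  have hsnd : ∀ e, σ e ≠ e → ((0, z e) : FreeCircles E × FreeCircles E) ∈ T := fun e he => by
    have := hmem (σ e) e
    rwa [if_neg he.symm, h.invol, if_pos rfl, one_smul, zero_smul, zero_add] at this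
  have hone : ((1, 0) : FreeCircles E × FreeCircles E) ∈ T := by
    have := mul_mem (hfst _ he₀) (star_mem (hfst _ he₀))
    rwa [Prod.star_def, Prod.mk_mul_mk, (z_unitary _).2, zero_mul] at this
  have hone' : ((0, 1) : FreeCircles E × FreeCircles E) ∈ T := by
    have := sub_mem (one_mem T) hone
    rwa [← Prod.mk_one_one, Prod.mk_sub_mk, sub_self, sub_zero] at this
  -- For a fixed edge, `(z e, z e)` is cut down by `(1, 0)`.
  have hfst' : ∀ e, ((z e, 0) : FreeCircles E × FreeCircles E) ∈ T := fun e => by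
    by_cases he : σ e = e
    · have := mul_mem (hmem e e) hone
      rwa [if_pos rfl, if_pos he.symm, one_smul, one_smul, Prod.mk_add_mk, Prod.mk_mul_mk,
        add_zero, mul_one, mul_zero] at this
    · exact hfst e he
  have hsnd' : ∀ e, ((0, z e) : FreeCircles E × FreeCircles E) ∈ T := fun e => by
    by_cases he : σ e = e
    · have := mul_mem (hmem e e) hone'
      rwa [if_pos rfl, if_pos he.symm, one_smul, one_smul, Prod.mk_add_mk, Prod.mk_mul_mk,
        zero_add, mul_one, mul_zero, he] at this
    · exact hsnd e he
  have hle : ∀ x ∈ T, x ∈ T.topologicalClosure := fun x hx => T.le_topologicalClosure hx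
  intro x
  change x ∈ T.topologicalClosure
  refine prod_induction (P := fun x => x ∈ T.topologicalClosure) T.isClosed_topologicalClosure
    (hle _ hone) (hle _ hone') (fun e => hle _ (hfst' e)) (fun e => hle _ (hsnd' e))
    (fun e => hle _ ?_) (fun e => hle _ ?_) (fun c a ha => SMulMemClass.smul_mem c ha)
    (fun a b => mul_mem) (fun a b => add_mem) x
  · have := star_mem (hfst' e)
    rwa [Prod.star_def, star_zero] at this
  · have := star_mem (hsnd' e)
    rwa [Prod.star_def, star_zero] at this

theorem action_linear : Γ.IsLinearAction (Γ.doubledAction h) := by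
  classical
  refine ⟨fun f e => (if f = e then (z e, 0) else 0) + (if f = σ e then (0, z (σ e)) else 0),
    fun e => ?_⟩
  simp only [MinTensor.tmul_add, Finset.sum_add_distrib]
  rw [action_S, Finset.sum_eq_single e, Finset.sum_eq_single (σ e), if_pos rfl, if_pos rfl]
  · intro f _ hf
    rw [if_neg hf, MinTensor.tmul_zero]
  · simp
  · intro f _ hf
    rw [if_neg hf, MinTensor.tmul_zero]
  · simp

/-- `α (S e S f*)` has two terms, indexed by `(e, f)` and `(σ e, σ f)`. Injectivity of `σ` makes `τ`
take the same value `δ_{ef}` on both first legs, and for `e = f` the second legs add up to `(1, 0) +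
(0, 1)`. -/
theorem action_preservesTau : Γ.PreservesTau (Γ.doubledAction h) := by
  classical
  refine ⟨Γ.tau, Γ.isTau_tau, fun x => ?_⟩
  -- Written with `tauExt`, the scalar makes sense for elements of the ambient algebra, as induction
  -- over the span requires.
  have key : ∀ x ∈ Γ.V2plus, ∃ y : Γ.V2plus ⊗[ℂ] (FreeCircles E × FreeCircles E),
      MinTensor.ofAlg (TensorProduct.map Γ.V2plus.subtype LinearMap.id y) =
        Γ.doubledAction h x ∧
      TensorProduct.lid ℂ _ (TensorProduct.map Γ.tau LinearMap.id y) = Γ.tauExt x • 1 := by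
    intro x hx
    refine Submodule.span_induction (p := fun x _ =>
      ∃ y : Γ.V2plus ⊗[ℂ] (FreeCircles E × FreeCircles E),
      MinTensor.ofAlg (TensorProduct.map Γ.V2plus.subtype LinearMap.id y) =
        Γ.doubledAction h x ∧
      TensorProduct.lid ℂ _ (TensorProduct.map Γ.tau LinearMap.id y) = Γ.tauExt x • 1)
      ?_ ?_ ?_ ?_ hx
    · rintro _ (⟨u, hu, rfl⟩ | ⟨e, f, hef, rfl⟩)
      · refine ⟨⟨Γ.p u, Submodule.subset_span (Or.inl ⟨u, hu, rfl⟩)⟩ ⊗ₜ 1, ?_, rfl⟩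
        rw [action_p]
        rfl
      · have hm : ∀ e f, Γ.r e = Γ.r f → Γ.S e * star (Γ.S f) ∈ Γ.V2plus := fun e f hef =>
          Submodule.subset_span (Or.inr ⟨e, f, hef, rfl⟩)
        -- Preservation of ranges keeps the permuted term inside `V2plus`.
        have hef' : Γ.r (σ e) = Γ.r (σ f) := by rw [h.r_eq, h.r_eq, hef]
        refine ⟨⟨_, hm e f hef⟩ ⊗ₜ (z e * star (z f), 0) +
          ⟨_, hm (σ e) (σ f) hef'⟩ ⊗ₜ (0, z (σ e) * star (z (σ f))), ?_, ?_⟩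
        · rw [map_mul, map_star]
          refine Eq.trans ?_ (edgeImage_mul_star Γ σ e f).symm |>.trans ?_
          · rw [map_add, map_add]
            rfl
          · rw [action_S, action_S]
            rfl
        · rw [map_add, map_add, TensorProduct.map_tmul, TensorProduct.map_tmul,
            TensorProduct.lid_tmul, TensorProduct.lid_tmul]
          change Γ.tauExt (Γ.S e * star (Γ.S f)) • (z e * star (z f), (0 : FreeCircles E)) +
            Γ.tauExt (Γ.S (σ e) * star (Γ.S (σ f))) •
              ((0 : FreeCircles E), z (σ e) * star (z (σ f))) = _
          rw [Γ.tauExt_S_mul_star, Γ.tauExt_S_mul_star]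
          by_cases hfe : e = f
          · subst hfe
            rw [if_pos rfl, if_pos rfl, one_smul, one_smul, one_smul, (z_unitary _).2,
              (z_unitary _).2, Prod.mk_add_mk, add_zero, zero_add, Prod.mk_one_one]
          · rw [if_neg hfe, if_neg (fun h' => hfe (σ.injective h')), zero_smul, zero_smul,
              zero_smul, add_zero]
    · exact ⟨0, by simp, by simp⟩
    · rintro x y _ _ ⟨a, ha, ha'⟩ ⟨b, hb, hb'⟩
      refine ⟨a + b, ?_, ?_⟩
      · rw [map_add, map_add, map_add, ha, hb]
      · rw [map_add, map_add, map_add, ha', hb', add_smul]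
    · rintro c x _ ⟨a, ha, ha'⟩
      refine ⟨c • a, ?_, ?_⟩
      · rw [map_smul, map_smul, map_smul, ha]
      · rw [map_smul, map_smul, map_smul, ha', smul_assoc]
  exact key x x.2

/-- The doubling acts on the graph C*-algebra as an object of the category. -/
theorem isObject {e₀ : E} (he₀ : σ e₀ ≠ e₀) : Γ.IsObject (doubledComul σ) (Γ.doubledAction h) where
  isCQG := isCompactQuantumGroup_doubling h.invol
  faithfulAction := ⟨h.action_coassoc, h.action_dense, h.action_faithful he₀⟩
  isLinear := h.action_linear
  preservesTau := h.action_preservesTau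

end IsEdgeSymmetry

end DirectedGraph

/-! ### The doubling is not a quotient of the free product of circles -/

namespace MinTensor

variable {A B C D : Type u} [CStarAlgebra A] [CStarAlgebra B] [CStarAlgebra C] [CStarAlgebra D]

theorem map_map {A' B' : Type u} [CStarAlgebra A'] [CStarAlgebra B'] (f' : C →⋆ₙₐ[ℂ] A')
    (g' : D →⋆ₙₐ[ℂ] B') (f : A →⋆ₙₐ[ℂ] C) (g : B →⋆ₙₐ[ℂ] D) (x : MinTensor A B) :
    map f' g' (map f g x) = map (f'.comp f) (g'.comp g) x := by
  refine denseRange_ofAlg.induction_on x (isClosed_eq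
    ((continuous_map f' g').comp (continuous_map f g)) (continuous_map _ _)) fun t => ?_
  induction t using TensorProduct.induction_on with
  | zero => simp only [map_zero]
  | add s t hs ht => simp only [map_add, hs, ht]
  | tmul a b =>
    change map f' g' (map f g (tmul a b)) = map (f'.comp f) (g'.comp g) (tmul a b)
    rw [map_tmul, map_tmul, map_tmul]
    rfl

/-- The tensor square of an algebra of operators on a non-zero space is non-zero. -/
theorem one_ne_zero_of_operators {H : Type u} [NormedAddCommGroup H] [InnerProductSpace ℂ H]
    [CompleteSpace H] [Nontrivial H] : (1 : MinTensor (H →L[ℂ] H) (H →L[ℂ] H)) ≠ 0 := by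
  intro h0
  obtain ⟨ξ, hξ⟩ := exists_ne (0 : H)
  have h1 : (minNorm (H →L[ℂ] H) (H →L[ℂ] H)).toFun (1 ⊗ₜ 1) = 0 := by
    rw [← CStarSeminorm.norm_coe]
    change ‖(tmul 1 1 : MinTensor (H →L[ℂ] H) (H →L[ℂ] H))‖ = 0
    rw [← one_def, h0, norm_zero]
  -- The minimal norm dominates the one from the identity representations, in which `1 ⊗ 1` fixes
  -- the non-zero vector `ξ ⊗ ξ`.
  have h2 := CStarSeminorm.le_sup (repSeminorms (H →L[ℂ] H) (H →L[ℂ] H)) (repSeminorms_bdd _ _)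
    ⟨H, H, _, _, _, _, _, _, NonUnitalStarAlgHom.id ℂ _, NonUnitalStarAlgHom.id ℂ _, rfl⟩
    ((1 : H →L[ℂ] H) ⊗ₜ (1 : H →L[ℂ] H))
  have h3 := h2.trans_eq h1
  rw [repSeminorm_apply, rep_tmul] at h3
  have h4 := (ContinuousLinearMap.le_opNorm (TensorProduct.mapL (1 : H →L[ℂ] H) (1 : H →L[ℂ] H))
    (ξ ⊗ₜ[ℂ] ξ)).trans (mul_le_mul_of_nonneg_right h3 (norm_nonneg _))
  rw [TensorProduct.mapL_tmul, zero_mul] at h4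
  change ‖ξ ⊗ₜ[ℂ] ξ‖ ≤ 0 at h4
  rw [TensorProduct.norm_tmul] at h4
  have := norm_pos_iff.2 hξ
  exact (mul_pos this this).not_ge h4

end MinTensor

namespace FreeCircles

variable {E : Type u}

/-- The free product of circles is cocommutative: scalar-valued homomorphisms commute under
convolution. -/
theorem map_comul_comm {B : Type u} [CStarAlgebra B] (f g : FreeCircles E →⋆ₐ[ℂ] B)
    (hf : ∀ a, ∃ c : ℂ, f a = c • 1) (hg : ∀ a, ∃ c : ℂ, g a = c • 1) (a : FreeCircles E) :
    MinTensor.map (f : FreeCircles E →⋆ₙₐ[ℂ] B) (g : FreeCircles E →⋆ₙₐ[ℂ] B) (comul E a) =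
      MinTensor.map (g : FreeCircles E →⋆ₙₐ[ℂ] B) (f : FreeCircles E →⋆ₙₐ[ℂ] B) (comul E a) := by
  have hgl : ∀ u, IsGroupLike u →
      MinTensor.map (f : FreeCircles E →⋆ₙₐ[ℂ] B) (g : FreeCircles E →⋆ₙₐ[ℂ] B) (comul E u) =
      MinTensor.map (g : FreeCircles E →⋆ₙₐ[ℂ] B) (f : FreeCircles E →⋆ₙₐ[ℂ] B) (comul E u) := by
    intro u hu
    rw [hu.comul_eq, MinTensor.map_tmul, MinTensor.map_tmul]
    change MinTensor.tmul (f u) (g u) = MinTensor.tmul (g u) (f u)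
    obtain ⟨c, hc⟩ := hf u
    obtain ⟨d, hd⟩ := hg u
    rw [hc, hd]
    simp only [MinTensor.smul_tmul, MinTensor.tmul_smul]
    rw [smul_comm]
  exact (unitaryRelations E).univ_hom_ext
    ((MinTensor.map (f : FreeCircles E →⋆ₙₐ[ℂ] B) (g : FreeCircles E →⋆ₙₐ[ℂ] B)).comp
      (comul E : FreeCircles E →⋆ₙₐ[ℂ] MinTensor (FreeCircles E) (FreeCircles E)))
    ((MinTensor.map (g : FreeCircles E →⋆ₙₐ[ℂ] B) (f : FreeCircles E →⋆ₙₐ[ℂ] B)).comp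
      (comul E : FreeCircles E →⋆ₙₐ[ℂ] MinTensor (FreeCircles E) (FreeCircles E)))
    (hgl 1 isGroupLike_one) (fun e => hgl _ (isGroupLike_z e)) a

/-- The homomorphism with scalar values `c e` of modulus one at the generators. -/
def character (B : Type u) [CStarAlgebra B] (c : E → ℂ) (hc : ∀ e, star (c e) * c e = 1) :
    FreeCircles E →⋆ₐ[ℂ] B :=
  (unitaryRelations E).lift (fun e => c e • 1) fun e => by
    simp only [star_smul, star_one, smul_mul_smul_comm, mul_one]
    rw [hc, mul_comm, hc, one_smul]
    exact ⟨rfl, rfl⟩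

variable {B : Type u} [CStarAlgebra B]

theorem character_z (c : E → ℂ) (hc : ∀ e, star (c e) * c e = 1) (e : E) :
    character B c hc (z e) = c e • 1 :=
  (unitaryRelations E).lift_gen (fun e => c e • (1 : B)) _ e

/-- The multiples of the unit form a closed subalgebra containing the images of the generators.
Scalars sit inside an algebra `B` because all C*-algebras here live in `Type u`. -/
theorem character_scalar (c : E → ℂ) (hc : ∀ e, star (c e) * c e = 1) (a : FreeCircles E) :
    ∃ d : ℂ, character B c hc a = d • 1 := by
  have key : character B c hc a ∈ Submodule.span ℂ {(1 : B)} := by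
    refine (unitaryRelations E).univ_induction
      (P := fun a => character B c hc a ∈ Submodule.span ℂ {(1 : B)})
      ((Submodule.closed_of_finiteDimensional _).preimage (StarAlgHom.continuous_of_cstar _))
      ?_ ?_ ?_ ?_ ?_ ?_ a
    · rw [map_one]
      exact Submodule.mem_span_singleton_self 1
    · intro e
      exact Submodule.mem_span_singleton.2 ⟨c e, (character_z c hc e).symm⟩
    · intro e
      rw [map_star]
      refine Submodule.mem_span_singleton.2 ⟨star (c e), ?_⟩
      have := congrArg star (character_z (B := B) c hc e)
      rw [star_smul, star_one] at this
      exact this.symm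
    · intro d a ha
      rw [map_smul]
      exact Submodule.smul_mem _ _ ha
    · intro a b ha hb
      obtain ⟨x, hx⟩ := Submodule.mem_span_singleton.1 ha
      obtain ⟨y, hy⟩ := Submodule.mem_span_singleton.1 hb
      refine Submodule.mem_span_singleton.2 ⟨x * y, ?_⟩
      rw [map_mul, ← hx, ← hy, smul_mul_smul_comm, mul_one]
    · intro a b ha hb
      rw [map_add]
      exact add_mem ha hb
  obtain ⟨d, hd⟩ := Submodule.mem_span_singleton.1 key
  exact ⟨d, hd.symm⟩

/-- The doubling by a non-trivial permutation is not a quotient quantum group of the free product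
of circles, since it is not cocommutative. -/
theorem not_surjective_of_isCQGMorphism {σ : Equiv.Perm E} {e₀ : E} (he₀ : σ e₀ ≠ e₀)
    (Θ : FreeCircles E →⋆ₐ[ℂ] FreeCircles E × FreeCircles E)
    (hΘ : IsCQGMorphism (comul E) (doubledComul σ) Θ) : ¬ Function.Surjective Θ := by
  classical
  intro hsurj
  let B : Type u := SeqOperators.{u}
  have hc : ∀ e : E, star ((fun _ => 1 : E → ℂ) e) * (fun _ => 1 : E → ℂ) e = 1 := by simp
  have hd : ∀ e : E, star ((fun e => if e = e₀ then -1 else 1 : E → ℂ) e) *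
      (fun e => if e = e₀ then -1 else 1 : E → ℂ) e = 1 := fun e => by
    dsimp only
    split_ifs <;> simp
  -- Both characters vanish on the first summand. On the second, `f` is trivial and `g` takes the
  -- value `-1` at `z e₀` only.
  let f : FreeCircles E × FreeCircles E →⋆ₐ[ℂ] B :=
    (character B _ hc).comp (StarAlgHom.snd ℂ _ _)
  let g : FreeCircles E × FreeCircles E →⋆ₐ[ℂ] B :=
    (character B _ hd).comp (StarAlgHom.snd ℂ _ _)
  obtain ⟨a, ha⟩ := hsurj (z e₀, 0)
  have h1 := map_comul_comm (f.comp Θ) (g.comp Θ) (fun a => character_scalar _ hc _)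
    (fun a => character_scalar _ hd _) a
  have hmap : ∀ f g : FreeCircles E × FreeCircles E →⋆ₐ[ℂ] B,
      MinTensor.map ((f.comp Θ : FreeCircles E →⋆ₐ[ℂ] B) : FreeCircles E →⋆ₙₐ[ℂ] B)
        ((g.comp Θ : FreeCircles E →⋆ₐ[ℂ] B) : FreeCircles E →⋆ₙₐ[ℂ] B) (comul E a) =
      MinTensor.tmul (f (z e₀, 0)) (g (z e₀, 0)) +
        MinTensor.tmul (f (0, z e₀)) (g (0, z (σ e₀))) := fun f g => by
    have h2 := MinTensor.map_map (f : FreeCircles E × FreeCircles E →⋆ₙₐ[ℂ] B)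
      (g : FreeCircles E × FreeCircles E →⋆ₙₐ[ℂ] B)
      (Θ : FreeCircles E →⋆ₙₐ[ℂ] FreeCircles E × FreeCircles E)
      (Θ : FreeCircles E →⋆ₙₐ[ℂ] FreeCircles E × FreeCircles E) (comul E a)
    refine h2.symm.trans ?_
    rw [hΘ a, ha, (isGroupLike_z e₀).doubledComul_zeta, map_add, MinTensor.map_tmul,
      MinTensor.map_tmul, permHom_z]
    rfl
  -- In one order `g` is evaluated at `z (σ e₀)`, giving `1 ⊗ 1`; in the other at `z e₀`, giving
  -- `-(1 ⊗ 1)`. Cocommutativity would force these to agree.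
  rw [hmap, hmap] at h1
  have hf0 : f (z e₀, 0) = 0 := map_zero (character B _ hc)
  have hg0 : g (z e₀, 0) = 0 := map_zero (character B _ hd)
  have hf : ∀ e, f (0, z e) = 1 := fun e => (character_z _ hc _).trans (one_smul _ _)
  have hg : ∀ e, g (0, z e) = (if e = e₀ then -1 else 1 : ℂ) • 1 := fun e => character_z _ hd _
  rw [hf0, hg0, hf, hf, hg, hg, if_pos rfl, if_neg he₀, MinTensor.smul_tmul, one_smul,
    ← MinTensor.one_def, MinTensor.tmul_zero, zero_add, zero_add, neg_smul, one_smul] at h1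
  refine MinTensor.one_ne_zero_of_operators (H := SeqHilbert.{u}) ?_
  have h3 : (2 : ℂ) • (1 : MinTensor B B) = 0 := by
    rw [two_smul]
    exact add_eq_zero_iff_eq_neg.2 h1
  exact (smul_eq_zero.1 h3).resolve_left two_ne_zero

end FreeCircles

/-! ### From universality to non-isomorphism -/

namespace DirectedGraph

open FreeCircles

variable {V E : Type u} {Γ : DirectedGraph V E}

theorem isEdgeSymmetry_swap [DecidableEq E] {e₁ e₂ : E} (hs : Γ.s e₁ = Γ.s e₂)
    (hr : Γ.r e₁ = Γ.r e₂) : Γ.IsEdgeSymmetry (Equiv.swap e₁ e₂) := by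
  refine ⟨fun e => Equiv.swap_apply_self e₁ e₂ e, fun e => ?_, fun e => ?_⟩
  all_goals
    rw [Equiv.swap_apply_def]
    split_ifs with h1 h2
    · rw [h1]; simp only [hs, hr]
    · rw [h2]; simp only [hs, hr]
    · rfl

variable [Fintype V] [Fintype E]

/-- If the graph has a non-trivial symmetry that preserves sources and ranges, then the universal
object is not the free product of circles. -/
theorem IsEdgeSymmetry.not_areIsomorphicCQG {σ : Equiv.Perm E} (h : Γ.IsEdgeSymmetry σ) {e₀ : E}
    (he₀ : σ e₀ ≠ e₀) {Q : Type u} [CStarAlgebra Q] {Δ : Q →⋆ₐ[ℂ] MinTensor Q Q}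
    {α : Γ.CStar →⋆ₐ[ℂ] MinTensor Γ.CStar Q} (hα : Γ.IsUniversalObject Δ α) :
    ¬ AreIsomorphicCQG Δ (comul E) := by
  rintro ⟨ψ, hψ⟩
  -- Only the surjective morphism onto the doubling is needed, not its compatibility with the
  -- actions.
  obtain ⟨Φ, hΦ, hΦ', -⟩ := hα.2 _ _ _ (h.isObject he₀)
  have hsymm : ∀ a, ψ.symm (ψ a) = a := ψ.symm_apply_apply
  let Θ : FreeCircles E →⋆ₐ[ℂ] FreeCircles E × FreeCircles E :=
    Φ.comp (ψ.symm : FreeCircles E →⋆ₐ[ℂ] Q)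
  refine not_surjective_of_isCQGMorphism he₀ Θ (fun b => ?_) fun x => ?_
  -- The morphism property is known for `ψ`, not for its inverse; writing `b = ψ a` avoids inverting
  -- it.
  · obtain ⟨a, rfl⟩ : ∃ a, ψ a = b := ψ.surjective b
    have h1 : comul E (ψ a) = _ := (hψ a).symm
    have h2 : (Θ : FreeCircles E →⋆ₙₐ[ℂ] FreeCircles E × FreeCircles E).comp
        ((ψ : Q →⋆ₐ[ℂ] FreeCircles E) : Q →⋆ₙₐ[ℂ] FreeCircles E) =
        (Φ : Q →⋆ₙₐ[ℂ] FreeCircles E × FreeCircles E) :=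
      NonUnitalStarAlgHom.ext fun x => congrArg Φ (hsymm x)
    rw [h1, MinTensor.map_map, h2, hΦ' a]
    exact congrArg (fun y => doubledComul σ (Φ y)) (hsymm a).symm
  · obtain ⟨a, rfl⟩ := hΦ x
    exact ⟨ψ a, congrArg Φ (hsymm a)⟩

end DirectedGraph

end

/-! ### The main theorem, with `σ` the transposition of the two parallel edges -/

theorem mainTheorem3 {V E : Type u} [Fintype V] [Fintype E] (Γ : DirectedGraph V E)
    (hΓ : Γ.IsConnected) :
    (∀ e₁ e₂ : E, e₁ ≠ e₂ → Γ.s e₁ = Γ.s e₂ → Γ.r e₁ = Γ.r e₂ →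
      -- the doubling of the free product acts faithfully on the graph C*-algebra in the category
      (IsCompactQuantumGroup (FreeCircles.comul E) ∧
        ∃ φ : FreeCircles E ≃⋆ₐ[ℂ] FreeCircles E,
          φ (FreeCircles.z e₁) = FreeCircles.z e₂ ∧
          φ (FreeCircles.z e₂) = FreeCircles.z e₁ ∧
          (∀ k, k ≠ e₁ → k ≠ e₂ → φ (FreeCircles.z k) = FreeCircles.z k) ∧
          (∀ a, φ (φ a) = a) ∧
          IsCQGMorphism (FreeCircles.comul E) (FreeCircles.comul E)
            (φ : FreeCircles E →⋆ₐ[ℂ] FreeCircles E) ∧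
          ∃ α : Γ.CStar →⋆ₐ[ℂ] MinTensor Γ.CStar (FreeCircles E × FreeCircles E),
            α (Γ.S e₁) = MinTensor.tmul (Γ.S e₁) (FreeCircles.z e₁, 0) +
              MinTensor.tmul (Γ.S e₂) (0, FreeCircles.z e₂) ∧
            α (Γ.S e₂) = MinTensor.tmul (Γ.S e₂) (FreeCircles.z e₂, 0) +
              MinTensor.tmul (Γ.S e₁) (0, FreeCircles.z e₁) ∧
            (∀ k, k ≠ e₁ → k ≠ e₂ →
              α (Γ.S k) = MinTensor.tmul (Γ.S k) (FreeCircles.z k, FreeCircles.z k)) ∧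
            Γ.IsObject (doublingComul (FreeCircles.comul E)
              (φ : FreeCircles E →⋆ₐ[ℂ] FreeCircles E)) α) ∧
      -- the universal object is not isomorphic to the free product
      (∀ (Q : Type u) [CStarAlgebra Q] (Δ : Q →⋆ₐ[ℂ] MinTensor Q Q)
        (α : Γ.CStar →⋆ₐ[ℂ] MinTensor Γ.CStar Q), Γ.IsUniversalObject Δ α →
        ¬ AreIsomorphicCQG Δ (FreeCircles.comul E))) ∧
    -- hence (R3) is necessary for the universal object to be isomorphic to the free product
    (∀ (Q : Type u) [CStarAlgebra Q] (Δ : Q →⋆ₐ[ℂ] MinTensor Q Q)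
      (α : Γ.CStar →⋆ₐ[ℂ] MinTensor Γ.CStar Q), Γ.IsUniversalObject Δ α →
      AreIsomorphicCQG Δ (FreeCircles.comul E) → Γ.SatisfiesR3) := by
  classical
  have noniso : ∀ e₁ e₂ : E, e₁ ≠ e₂ → Γ.s e₁ = Γ.s e₂ → Γ.r e₁ = Γ.r e₂ →
      ∀ (Q : Type u) [CStarAlgebra Q] (Δ : Q →⋆ₐ[ℂ] MinTensor Q Q)
        (α : Γ.CStar →⋆ₐ[ℂ] MinTensor Γ.CStar Q), Γ.IsUniversalObject Δ α →
        ¬ AreIsomorphicCQG Δ (FreeCircles.comul E) := fun e₁ e₂ hne hs hr Q _ Δ α hα =>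
    (DirectedGraph.isEdgeSymmetry_swap hs hr).not_areIsomorphicCQG (e₀ := e₁)
      (by rw [Equiv.swap_apply_left]; exact hne.symm) hα
  refine ⟨fun e₁ e₂ hne hs hr => ⟨⟨FreeCircles.isCompactQuantumGroup, ?_⟩,
    noniso e₁ e₂ hne hs hr⟩, fun Q _ Δ α hα hiso e f hs hr => ?_⟩
  · have h := DirectedGraph.isEdgeSymmetry_swap hs hr
    have hz : ∀ e, FreeCircles.permEquiv (Equiv.swap e₁ e₂) h.invol (FreeCircles.z e) =
      FreeCircles.z (Equiv.swap e₁ e₂ e) := FreeCircles.permHom_z _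
    refine ⟨FreeCircles.permEquiv (Equiv.swap e₁ e₂) h.invol, ?_, ?_, fun k h₁ h₂ => ?_,
      FreeCircles.permHom_permHom h.invol, FreeCircles.isCQGMorphism_permHom _,
      Γ.doubledAction h, ?_, ?_, fun k h₁ h₂ => ?_, h.isObject (e₀ := e₁) ?_⟩
    · rw [hz, Equiv.swap_apply_left]
    · rw [hz, Equiv.swap_apply_right]
    · rw [hz, Equiv.swap_apply_of_ne_of_ne h₁ h₂]
    · rw [h.action_S, Equiv.swap_apply_left]
    · rw [h.action_S, Equiv.swap_apply_right]
    · rw [h.action_S, Equiv.swap_apply_of_ne_of_ne h₁ h₂, ← MinTensor.tmul_add, Prod.mk_add_mk,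
        add_zero, zero_add]
    · rw [Equiv.swap_apply_left]
      exact hne.symm
  · by_contra hne
    exact noniso e f hne hs hr Q Δ α hα hiso
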